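/- Let $H_1$ be an infinite-dimensional separable real Hilbert space, $G_1$ a real Hilbert space, $S_1\colon H_1\to G_1$ a compact linear operator and $W_1=S_1^\dagger S_1$. Let $\{(e_m,\lambda_m) : m\in\mathbb N\}$ be the eigenpairs of $W_1$ in non-increasing order, i.e. $W_1e_m=\lambda_me_m$, $\langle e_i,e_j\rangle=\delta_{i,j}$, $\lambda_1\ge\lambda_2\ge\dots\ge0$, and $W_1$ vanishes on the orthogonal complement of $\{e_m\}$ (so every non-zero eigenvalue is listed with full multiplicity; this holds in particular if $\{e_m\}$ is an orthonormal basis of $H_1$). Let $d>1$. Let $H_d=H_1\otimes\dots\otimes H_1$ and $G_d=G_1\otimes\dots\otimes G_1$ be the $d$-fold Hilbert space tensor products, with $\langle\bigotimes f_l,\bigotimes g_l\rangle=\prod_l\langle f_l,g_l\rangle$, and let $S_d=S_1\otimes\dots\otimes S_1\colon H_d\to G_d$ and $W_d=S_d^\dagger S_d$. Let $\emptyset\ne I=\{i_1<\dots<i_{\#I}\}\subset\{1,\dots,d\}$, and let $\mathcal S_I$ be the set of permutations of $\{1,\dots,d\}$ that fix every element outside $I$. Let $P_I$ be either the symmetrizer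 or the antisymmetrizer with respect to $I$, that is, the continuous linear operator on $H_d$ (or on $G_d$) with $$P_I\Big(\bigotimes_{l=1}^d f_l\Big)=\frac1{\#\mathcal S_I}\sum_{\pi\in\mathcal S_I}\varepsilon(\pi)\bigotimes_{l=1}^d f_{\pi(l)},$$ where $\varepsilon(\pi)=1$ in the symmetric case and $\varepsilon(\pi)=\operatorname{sgn}\pi$ in the antisymmetric case. Its range $P_I(H_d)$ is a closed subspace. Let $$\nabla_d=\{k\in\mathbb N^d : k_{i_1}\le\dots\le k_{i_{\#I}}\}\ \text{(symmetric case)},\qquad \nabla_d=\{k\in\mathbb N^d : k_{i_1}<\dots<k_{i_{\#I}}\}\ \text{(antisymmetric case)}.$$ For $k\in\nabla_d$ put $$\xi_k=\sqrt{\#\mathcal S_I/M_I(k)!}\;P_I(e_{k_1}\otimes\dots\otimes e_{k_d}),\qquad \lambda_{d,k}=\prod_{l=1}^d\lambda_{k_l},$$ where $M_I(k)!$ is the product, over the distinct values $m$ among $(k_i)_{i\in I}$, of $(\#\{i\in I : k_i=m\})!$. Then there is a bijection $\psi\colon\mathbb N\to\nabla_d$ for which $(\lambda_{d,\psi(v)})_{v\in\mathbb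 N}$ is non-increasing, and for every such $\psi$ the following holds. 1. $W_d$ restricted to $P_I(H_d)$ equals $(S_d|_{P_I(H_d)})^\dagger S_d|_{P_I(H_d)}\colon P_I(H_d)\to P_I(H_d)$, and its eigenpairs in non-increasing order (in the sense above) are $\{(\xi_{\psi(v)},\lambda_{d,\psi(v)}) : v\in\mathbb N\}=\{(\xi_k,\lambda_{d,k}) : k\in\nabla_d\}$. If $\{e_m\}$ is an orthonormal basis of $H_1$, then $\{\xi_k : k\in\nabla_d\}$ is an orthonormal basis of $P_I(H_d)$. 2. For every $n\in\mathbb N_0$ the linear algorithm $$A^*_{n,d}f=\sum_{v=1}^n\langle f,\xi_{\psi(v)}\rangle_{H_d}\,S_d\xi_{\psi(v)},\qquad f\in P_I(H_d),$$ which uses $n$ continuous linear functionals, maps $P_I(H_d)$ into $P_I(G_d)$ and is $n$-th optimal for $S_d$ on $P_I(H_d)$ in the worst case setting: $$e(n,d;P_I(H_d))=e^{\rm wor}(A^*_{n,d};P_I(H_d))=\sqrt{\lambda_{d,\psi(n+1)}}.$$ Here $e^{\rm wor}(A;P_I(H_d))=\sup\{\|Af-S_df\|_{G_d} : f\in P_I(H_d),\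 \|f\|\le1\}$, and $e(n,d;P_I(H_d))=\inf_A e^{\rm wor}(A;P_I(H_d))$ is the infimum over the union of the following two classes of algorithms $A=\phi\circ N\colon P_I(H_d)\to G_d$ with arbitrary $\phi\colon\mathbb R^n\to G_d$: (a) $N(f)=(L_1(f),\dots,L_n(f))$ with continuous, not necessarily linear, functionals $L_v$; (b) adaptive linear information $N(f)=(y_1,\dots,y_n)$, $y_v=L_v(f;y_1,\dots,y_{v-1})$, where each $L_v(\cdot\,;y_1,\dots,y_{v-1})$ is a continuous linear functional. The infimum has the same value over every smaller class that contains all linear algorithms $f\mapsto\sum_{v=1}^nL_v(f)g_v$ with continuous linear functionals $L_v$ and $g_v\in G_d$. -/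

import Mathlib

open scoped TensorProduct Matrix

noncomputable section

/-! ### The `d`-fold Hilbert space tensor product -/

/-- The algebraic `d`-fold tensor product of `H` over the reals (finite linear combinations of
simple tensors), as a type of its own, so that it can carry the Hilbertian (cross) seminorm. -/
def AlgTensorPower (d : ℕ) (H : Type*) [AddCommGroup H] [Module ℝ H] : Type _ :=
  ⨂[ℝ] _ : Fin d, H

namespace AlgTensorPower

section Algebra

variable {d : ℕ} {H : Type*} [AddCommGroup H] [Module ℝ H]

instance : AddCommGroup (AlgTensorPower d H) :=
  inferInstanceAs (AddCommGroup (⨂[ℝ] _ : Fin d, H))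

instance : Module ℝ (AlgTensorPower d H) :=
  inferInstanceAs (Module ℝ (⨂[ℝ] _ : Fin d, H))

/-- The simple tensor `f 0 ⊗ ⋯ ⊗ f (d - 1)`. -/
def tprod (d : ℕ) (H : Type*) [AddCommGroup H] [Module ℝ H] :
    MultilinearMap ℝ (fun _ : Fin d => H) (AlgTensorPower d H) :=
  PiTensorProduct.tprod ℝ

theorem exists_sum (t : AlgTensorPower d H) :
    ∃ (n : ℕ) (c : Fin n → ℝ) (f : Fin n → Fin d → H), t = ∑ i, c i • tprod d H (f i) := by
  have ht : t ∈ Submodule.span ℝ (Set.range (tprod d H)) := by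
    have h : Submodule.span ℝ (Set.range (tprod d H)) = ⊤ :=
      PiTensorProduct.span_tprod_eq_top
    rw [h]
    trivial
  obtain ⟨n, c, g, hg⟩ := Submodule.mem_span_set'.1 ht
  choose f hf using fun i => (g i).2
  exact ⟨n, c, f, by rw [← hg]; simp [hf]⟩

theorem hom_ext {E : Type*} [AddCommGroup E] [Module ℝ E] {φ ψ : AlgTensorPower d H →ₗ[ℝ] E}
    (h : ∀ f, φ (tprod d H f) = ψ (tprod d H f)) : φ = ψ :=
  PiTensorProduct.ext (MultilinearMap.ext h)

end Algebra

variable {d : ℕ} {H G : Type*} [NormedAddCommGroup H] [InnerProductSpace ℝ H]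
  [NormedAddCommGroup G] [InnerProductSpace ℝ G]

/-- The bilinear form on the algebraic tensor product that is determined by
`⟨⊗ f_l, ⊗ g_l⟩ = ∏ ⟨f_l, g_l⟩`. -/
def form (d : ℕ) (H : Type*) [NormedAddCommGroup H] [InnerProductSpace ℝ H] :
    AlgTensorPower d H →ₗ[ℝ] AlgTensorPower d H →ₗ[ℝ] ℝ :=
  (PiTensorProduct.map₂ (R := ℝ) (fun _ : Fin d => innerₗ H)).compr₂
    (PiTensorProduct.lift (MultilinearMap.mkPiAlgebra ℝ (Fin d) ℝ))

theorem form_tprod (f g : Fin d → H) :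
    form d H (tprod d H f) (tprod d H g) = ∏ l, inner ℝ (f l) (g l) := by
  have h : form d H (tprod d H f) (tprod d H g) =
      PiTensorProduct.lift (MultilinearMap.mkPiAlgebra ℝ (Fin d) ℝ)
        (PiTensorProduct.map₂ (R := ℝ) (fun _ : Fin d => innerₗ H)
          (PiTensorProduct.tprod ℝ f) (PiTensorProduct.tprod ℝ g)) := rfl
  rw [h, PiTensorProduct.map₂_tprod_tprod]
  simp

theorem form_symm (s t : AlgTensorPower d H) : form d H s t = form d H t s := by
  have h : form d H = (form d H).flip :=
    hom_ext fun f => hom_ext fun g => by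
      simp only [LinearMap.flip_apply, form_tprod, real_inner_comm]
  exact congrArg (fun B => B s t) h

theorem form_sum {n : ℕ} (c : Fin n → ℝ) (f : Fin n → Fin d → H) :
    form d H (∑ i, c i • tprod d H (f i)) (∑ i, c i • tprod d H (f i)) =
      c ⬝ᵥ ((Matrix.of fun i j => ∏ l, inner ℝ (f i l) (f j l)) *ᵥ c) := by
  simp only [map_sum, map_smul, LinearMap.sum_apply, LinearMap.smul_apply, form_tprod,
    smul_eq_mul, dotProduct, Matrix.mulVec, Matrix.of_apply, Finset.mul_sum]
  rw [Finset.sum_comm]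
  refine Finset.sum_congr rfl fun i _ => Finset.sum_congr rfl fun j _ => ?_
  ring

theorem gram_bound {n : ℕ} (S : H →L[ℝ] G) (v : Fin n → H) :
    (Matrix.of fun i j =>
      ‖S‖ ^ 2 * inner ℝ (v i) (v j) - inner ℝ (S (v i)) (S (v j))).PosSemidef := by
  have h1 : (Matrix.of fun i j =>
      ‖S‖ ^ 2 * inner ℝ (v i) (v j) - inner ℝ (S (v i)) (S (v j))) =
      ‖S‖ ^ 2 • Matrix.gram ℝ v - Matrix.gram ℝ (fun i => S (v i)) := by
    ext i j
    simp [Matrix.gram_apply]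
  rw [h1]
  refine .of_dotProduct_mulVec_nonneg ?_ fun x => ?_
  · exact ((Matrix.isHermitian_gram ℝ v).smul (by simp [IsSelfAdjoint])).sub
      (Matrix.isHermitian_gram ℝ _)
  · rw [Matrix.sub_mulVec, dotProduct_sub, Matrix.smul_mulVec, dotProduct_smul,
      Matrix.star_dotProduct_gram_mulVec, Matrix.star_dotProduct_gram_mulVec]
    have h2 : ∑ i, x i • S (v i) = S (∑ i, x i • v i) := by simp
    rw [h2, real_inner_self_eq_norm_sq, real_inner_self_eq_norm_sq, smul_eq_mul, ← mul_pow,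
      sub_nonneg]
    exact pow_le_pow_left₀ (norm_nonneg _) (S.le_opNorm _) 2

theorem posSemidef_prod {n : ℕ} (f : Fin n → Fin d → H) (s : Finset (Fin d)) :
    (Matrix.of fun i j => ∏ l ∈ s, inner ℝ (f i l) (f j l)).PosSemidef := by
  induction s using Finset.induction_on with
  | empty =>
    have h : (Matrix.of fun i j => ∏ l ∈ (∅ : Finset (Fin d)), inner ℝ (f i l) (f j l)) =
        Matrix.gram ℝ (fun _ : Fin n => (1 : ℝ)) := by
      ext i j
      simp [Matrix.gram_apply]
    rw [h]
    exact Matrix.posSemidef_gram ℝ _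
  | insert a s ha ih =>
    have h : (Matrix.of fun i j => ∏ l ∈ insert a s, inner ℝ (f i l) (f j l)) =
        (Matrix.gram ℝ (fun i => f i a)).hadamard
          (Matrix.of fun i j => ∏ l ∈ s, inner ℝ (f i l) (f j l)) := by
      ext i j
      simp [Matrix.gram_apply, Finset.prod_insert ha]
    rw [h]
    exact (Matrix.posSemidef_gram ℝ _).hadamard ih

theorem posSemidef_bound {n : ℕ} (S : H →L[ℝ] G) (f : Fin n → Fin d → H) (s : Finset (Fin d)) :
    (Matrix.of fun i j => (∏ l ∈ s, ‖S‖ ^ 2 * inner ℝ (f i l) (f j l)) -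
      ∏ l ∈ s, inner ℝ (S (f i l)) (S (f j l))).PosSemidef := by
  induction s using Finset.induction_on with
  | empty =>
    simp only [Finset.prod_empty, sub_self]
    exact Matrix.PosSemidef.zero
  | insert a s ha ih =>
    have h : (Matrix.of fun i j => (∏ l ∈ insert a s, ‖S‖ ^ 2 * inner ℝ (f i l) (f j l)) -
        ∏ l ∈ insert a s, inner ℝ (S (f i l)) (S (f j l))) =
        (Matrix.of fun i j => ‖S‖ ^ 2 * inner ℝ (f i a) (f j a) -
          inner ℝ (S (f i a)) (S (f j a))).hadamard
          ((‖S‖ ^ 2) ^ s.card • Matrix.of fun i j => ∏ l ∈ s, inner ℝ (f i l) (f j l)) +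
        (Matrix.gram ℝ (fun i => S (f i a))).hadamard
          (Matrix.of fun i j => (∏ l ∈ s, ‖S‖ ^ 2 * inner ℝ (f i l) (f j l)) -
            ∏ l ∈ s, inner ℝ (S (f i l)) (S (f j l))) := by
      ext i j
      simp only [Matrix.of_apply, Matrix.add_apply, Matrix.hadamard_apply, Matrix.smul_apply,
        Matrix.gram_apply, Finset.prod_insert ha, Finset.prod_mul_distrib, Finset.prod_const,
        smul_eq_mul]
      ring
    rw [h]
    exact ((gram_bound S fun i => f i a).hadamard
      ((posSemidef_prod f s).smul (by positivity))).add
      ((Matrix.posSemidef_gram ℝ _).hadamard ih)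

theorem form_nonneg (t : AlgTensorPower d H) : 0 ≤ form d H t t := by
  obtain ⟨n, c, f, rfl⟩ := exists_sum t
  rw [form_sum]
  exact (posSemidef_prod f Finset.univ).dotProduct_mulVec_nonneg c

/-- The (semi-)inner product data on the algebraic tensor product. -/
@[reducible]
def core (d : ℕ) (H : Type*) [NormedAddCommGroup H] [InnerProductSpace ℝ H] :
    PreInnerProductSpace.Core ℝ (AlgTensorPower d H) where
  inner s t := form d H s t
  conj_inner_symm s t := form_symm t s
  re_inner_nonneg t := form_nonneg t
  add_left s t u := by simp
  smul_left s t r := by simp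

instance : SeminormedAddCommGroup (AlgTensorPower d H) :=
  @InnerProductSpace.Core.toSeminormedAddCommGroup ℝ (AlgTensorPower d H) _ _ _ (core d H)

instance : InnerProductSpace ℝ (AlgTensorPower d H) :=
  InnerProductSpace.ofCore (core d H)

theorem inner_def (s t : AlgTensorPower d H) : inner ℝ s t = form d H s t := rfl

/-- The algebraic tensor power `S ⊗ ⋯ ⊗ S` of an operator. -/
def mapₗ (d : ℕ) (S : H →L[ℝ] G) : AlgTensorPower d H →ₗ[ℝ] AlgTensorPower d G :=
  PiTensorProduct.map (fun _ : Fin d => (S : H →ₗ[ℝ] G))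

theorem mapₗ_tprod (S : H →L[ℝ] G) (f : Fin d → H) :
    mapₗ d S (tprod d H f) = tprod d G (fun l => S (f l)) :=
  PiTensorProduct.map_tprod _ _

theorem norm_mapₗ_le (S : H →L[ℝ] G) (t : AlgTensorPower d H) :
    ‖mapₗ d S t‖ ≤ ‖S‖ ^ d * ‖t‖ := by
  refine le_of_sq_le_sq ?_ (by positivity)
  rw [mul_pow, ← real_inner_self_eq_norm_sq, ← real_inner_self_eq_norm_sq, inner_def, inner_def]
  obtain ⟨n, c, f, rfl⟩ := exists_sum t
  simp only [map_sum (mapₗ d S), map_smul (mapₗ d S), mapₗ_tprod]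
  rw [form_sum, form_sum]
  have h := (posSemidef_bound S f Finset.univ).dotProduct_mulVec_nonneg c
  have h1 : (Matrix.of fun i j => (∏ l, ‖S‖ ^ 2 * inner ℝ (f i l) (f j l)) -
      ∏ l, inner ℝ (S (f i l)) (S (f j l))) =
      (‖S‖ ^ d) ^ 2 • (Matrix.of fun i j => ∏ l, inner ℝ (f i l) (f j l)) -
      Matrix.of fun i j => ∏ l, inner ℝ (S (f i l)) (S (f j l)) := by
    ext i j
    simp [Finset.prod_mul_distrib, ← pow_mul, mul_comm]
  rw [h1, Matrix.sub_mulVec, dotProduct_sub, Matrix.smul_mulVec, dotProduct_smul,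
    smul_eq_mul, sub_nonneg] at h
  simpa using h

/-- The permutation of tensor factors `⊗ f_l ↦ ⊗ f_{π(l)}`. -/
def permₗ (H : Type*) [NormedAddCommGroup H] [InnerProductSpace ℝ H] (π : Equiv.Perm (Fin d)) :
    AlgTensorPower d H →ₗ[ℝ] AlgTensorPower d H :=
  (PiTensorProduct.reindex ℝ (fun _ : Fin d => H) π.symm).toLinearMap

theorem permₗ_tprod (π : Equiv.Perm (Fin d)) (f : Fin d → H) :
    permₗ H π (tprod d H f) = tprod d H (fun l => f (π l)) :=
  PiTensorProduct.reindex_tprod _ _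

theorem norm_permₗ (π : Equiv.Perm (Fin d)) (t : AlgTensorPower d H) : ‖permₗ H π t‖ = ‖t‖ := by
  have h : (form d H).compl₁₂ (permₗ H π) (permₗ H π) = form d H :=
    hom_ext fun f => hom_ext fun g => by
      simp only [LinearMap.compl₁₂_apply, permₗ_tprod, form_tprod]
      exact Equiv.prod_comp π fun l => inner ℝ (f l) (g l)
  have h2 : ‖permₗ H π t‖ ^ 2 = ‖t‖ ^ 2 := by
    rw [← real_inner_self_eq_norm_sq, ← real_inner_self_eq_norm_sq, inner_def, inner_def]
    exact congrArg (fun B => B t t) h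
  exact (sq_eq_sq₀ (norm_nonneg _) (norm_nonneg _)).1 h2

end AlgTensorPower

/-- The `d`-fold tensor product Hilbert space `H ⊗ ⋯ ⊗ H`: the completion of the algebraic tensor
product with respect to the inner product with `⟨⊗ f_l, ⊗ g_l⟩ = ∏ ⟨f_l, g_l⟩`. -/
abbrev HilbertTensorPower (d : ℕ) (H : Type*) [NormedAddCommGroup H] [InnerProductSpace ℝ H] :
    Type _ :=
  UniformSpace.Completion (AlgTensorPower d H)

section Operators

variable {d : ℕ} {H G : Type*} [NormedAddCommGroup H] [InnerProductSpace ℝ H]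
  [NormedAddCommGroup G] [InnerProductSpace ℝ G]

/-- The simple tensor `f 0 ⊗ ⋯ ⊗ f (d - 1)` in the tensor product Hilbert space. -/
def pureTensor (f : Fin d → H) : HilbertTensorPower d H :=
  ((AlgTensorPower.tprod d H f : AlgTensorPower d H) : HilbertTensorPower d H)

/-- The defining property of the inner product. -/
theorem inner_pureTensor (f g : Fin d → H) :
    inner ℝ (pureTensor f) (pureTensor g) = ∏ l, inner ℝ (f l) (g l) := by
  rw [pureTensor, pureTensor, UniformSpace.Completion.inner_coe, AlgTensorPower.inner_def,
    AlgTensorPower.form_tprod]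

/-- The tensor product operator `S_d = S ⊗ ⋯ ⊗ S`. -/
def tensorOp (d : ℕ) (S : H →L[ℝ] G) : HilbertTensorPower d H →L[ℝ] HilbertTensorPower d G :=
  ((AlgTensorPower.mapₗ d S).mkContinuous (‖S‖ ^ d)
    (AlgTensorPower.norm_mapₗ_le S)).completion

theorem tensorOp_pureTensor (S : H →L[ℝ] G) (f : Fin d → H) :
    tensorOp d S (pureTensor f) = pureTensor (fun l => S (f l)) := by
  simp [tensorOp, pureTensor, AlgTensorPower.mapₗ_tprod]

/-- The operator that permutes the tensor factors, `⊗ f_l ↦ ⊗ f_{π(l)}`. -/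
def permOp (H : Type*) [NormedAddCommGroup H] [InnerProductSpace ℝ H] (π : Equiv.Perm (Fin d)) :
    HilbertTensorPower d H →L[ℝ] HilbertTensorPower d H :=
  ((AlgTensorPower.permₗ H π).mkContinuous 1
    fun t => by rw [AlgTensorPower.norm_permₗ, one_mul]).completion

theorem permOp_pureTensor (π : Equiv.Perm (Fin d)) (f : Fin d → H) :
    permOp H π (pureTensor f) = pureTensor (fun l => f (π l)) := by
  simp [permOp, pureTensor, AlgTensorPower.permₗ_tprod]

/-- Continuous linear maps on the tensor product are determined by the simple tensors. -/
theorem tensor_hom_ext {E : Type*} [NormedAddCommGroup E] [NormedSpace ℝ E]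
    {φ ψ : HilbertTensorPower d H →L[ℝ] E}
    (h : ∀ f : Fin d → H, φ (pureTensor f) = ψ (pureTensor f)) : φ = ψ := by
  ext x
  induction x using UniformSpace.Completion.induction_on with
  | hp => exact isClosed_eq φ.continuous ψ.continuous
  | ih t =>
    obtain ⟨n, c, f, rfl⟩ := AlgTensorPower.exists_sum t
    have h1 : ((∑ i, c i • AlgTensorPower.tprod d H (f i) : AlgTensorPower d H) :
        HilbertTensorPower d H) = ∑ i, c i • pureTensor (f i) := by
      have := map_sum (UniformSpace.Completion.toComplL (𝕜 := ℝ) (E := AlgTensorPower d H))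
        (fun i => c i • AlgTensorPower.tprod d H (f i)) Finset.univ
      simp only [map_smul] at this
      exact this
    rw [h1]
    simp [h]

theorem permOp_comp (π σ : Equiv.Perm (Fin d)) :
    (permOp H π).comp (permOp H σ) = permOp H (σ * π) :=
  tensor_hom_ext fun f => by
    simp only [ContinuousLinearMap.comp_apply, permOp_pureTensor, Equiv.Perm.mul_apply]

end Operators

/-! ### (Anti-)symmetrizers and (anti-)symmetric subspaces -/

/-- The two kinds of symmetry conditions. -/
inductive SymmetryType
  | symmetric
  | antisymmetric

/-- The factor of a permutation: `1` in the symmetric case, the sign `(-1)^{|π|}` in the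
antisymmetric case. -/
def SymmetryType.factor {d : ℕ} : SymmetryType → Equiv.Perm (Fin d) → ℝ
  | .symmetric, _ => 1
  | .antisymmetric, π => ((Equiv.Perm.sign π : ℤ) : ℝ)

/-- The permutations of all coordinates that leave the complement of `I` pointwise fixed. -/
def permsOn {d : ℕ} (I : Finset (Fin d)) : Finset (Equiv.Perm (Fin d)) :=
  Finset.univ.filter fun π => ∀ i, i ∉ I → π i = i

section Symmetrizer

variable {d : ℕ} (s : SymmetryType) (I : Finset (Fin d)) (H : Type*) [NormedAddCommGroup H]
  [InnerProductSpace ℝ H]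

/-- The symmetrizer, or antisymmetrizer, with respect to the coordinates in `I`. -/
def symmetrizer : HilbertTensorPower d H →L[ℝ] HilbertTensorPower d H :=
  ((permsOn I).card : ℝ)⁻¹ • ∑ π ∈ permsOn I, s.factor π • permOp H π

theorem SymmetryType.factor_mul (π σ : Equiv.Perm (Fin d)) :
    s.factor (π * σ) = s.factor π * s.factor σ := by
  cases s <;> simp [SymmetryType.factor]

theorem symmetrizer_comp_self :
    (symmetrizer s I H).comp (symmetrizer s I H) = symmetrizer s I H := by
  have hone : (1 : Equiv.Perm (Fin d)) ∈ permsOn I := by simp [permsOn]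
  have hcard : ((permsOn I).card : ℝ) ≠ 0 := by
    exact_mod_cast (Finset.card_pos.2 ⟨_, hone⟩).ne'
  have hinner : ∀ π ∈ permsOn I,
      (∑ σ ∈ permsOn I, (s.factor π * s.factor σ) • (permOp H π).comp (permOp H σ)) =
        ∑ σ ∈ permsOn I, s.factor σ • permOp H σ := by
    intro π hπ
    simp only [permsOn, Finset.mem_filter, Finset.mem_univ, true_and] at hπ
    have hπ' : ∀ i, i ∉ I → π⁻¹ i = i := fun i hi => by
      rw [Equiv.Perm.inv_eq_iff_eq, hπ i hi]
    refine Finset.sum_bij' (fun σ _ => σ * π) (fun σ _ => σ * π⁻¹) ?_ ?_ ?_ ?_ ?_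
    · intro σ hσ
      simp only [permsOn, Finset.mem_filter, Finset.mem_univ, true_and] at hσ ⊢
      intro i hi
      rw [Equiv.Perm.mul_apply, hπ i hi, hσ i hi]
    · intro σ hσ
      simp only [permsOn, Finset.mem_filter, Finset.mem_univ, true_and] at hσ ⊢
      intro i hi
      rw [Equiv.Perm.mul_apply, hπ' i hi, hσ i hi]
    · intro σ _
      simp
    · intro σ _
      simp
    · intro σ _
      rw [permOp_comp, SymmetryType.factor_mul, mul_comm]
  have hsum : (∑ π ∈ permsOn I, s.factor π • permOp H π).comp
      (∑ π ∈ permsOn I, s.factor π • permOp H π) =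
      ((permsOn I).card : ℝ) • ∑ π ∈ permsOn I, s.factor π • permOp H π := by
    simp only [ContinuousLinearMap.finsetSum_comp, ContinuousLinearMap.comp_finsetSum,
      ContinuousLinearMap.smul_comp, ContinuousLinearMap.comp_smul, Finset.smul_sum, smul_smul]
    rw [Finset.sum_comm]
    simp only [mul_comm (s.factor _) (s.factor _)]
    rw [Finset.sum_congr rfl hinner, Finset.sum_const, ← Nat.cast_smul_eq_nsmul ℝ,
      Finset.smul_sum]
    simp only [smul_smul]
  unfold symmetrizer
  rw [ContinuousLinearMap.smul_comp, ContinuousLinearMap.comp_smul, hsum, smul_smul, smul_smul]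
  congr 1
  field_simp

/-- The subspace `P_I(H_d)` of `I`-symmetric, or `I`-antisymmetric, elements: the range of the
(anti-)symmetrizer. -/
def symSubspace : Submodule ℝ (HilbertTensorPower d H) :=
  LinearMap.range (symmetrizer s I H : HilbertTensorPower d H →ₗ[ℝ] HilbertTensorPower d H)

theorem isClosed_symSubspace :
    IsClosed (symSubspace s I H : Set (HilbertTensorPower d H)) := by
  have h : (symSubspace s I H : Set (HilbertTensorPower d H)) =
      {x | symmetrizer s I H x = x} := by
    ext x
    constructor
    · rintro ⟨y, rfl⟩
      exact congrArg (fun A => A y) (symmetrizer_comp_self s I H)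
    · intro hx
      exact ⟨x, hx⟩
  rw [h]
  exact isClosed_eq (symmetrizer s I H).continuous continuous_id

instance : CompleteSpace (symSubspace s I H) :=
  (isClosed_symSubspace s I H).completeSpace_coe

variable {H} {G : Type*} [NormedAddCommGroup G] [InnerProductSpace ℝ G]

/-- The restriction of `S_d = S ⊗ ⋯ ⊗ S` to the (anti-)symmetric subspace `P_I(H_d)`. -/
def symProblem (S : H →L[ℝ] G) : symSubspace s I H →L[ℝ] HilbertTensorPower d G :=
  (tensorOp d S).comp (symSubspace s I H).subtypeL

/-- The index set `∇_d`: multi-indices that are non-decreasing (symmetric case) or strictly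
increasing (antisymmetric case) along the coordinates in `I`. -/
def nabla : Set (Fin d → ℕ) :=
  match s with
  | .symmetric => {k | MonotoneOn k (I : Set (Fin d))}
  | .antisymmetric => {k | StrictMonoOn k (I : Set (Fin d))}

/-- `M_I(k)!`: the product, over the different integers `m` that occur in `k` among the coordinates
in `I`, of the factorial of the number of occurrences of `m` there. -/
def multFactorial (k : Fin d → ℕ) : ℕ :=
  ∏ m ∈ I.image k, (I.filter fun i => k i = m).card.factorial

/-- `ξ_k = √(#S_I / M_I(k)!) · P_I(e_{k_1} ⊗ ⋯ ⊗ e_{k_d})`, as an element of `P_I(H_d)`. -/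
def xi (e : ℕ → H) (k : Fin d → ℕ) : symSubspace s I H :=
  √(((permsOn I).card : ℝ) / (multFactorial I k : ℝ)) •
    ⟨symmetrizer s I H (pureTensor fun l => e (k l)), LinearMap.mem_range_self _ _⟩

/-- `λ_{d,k} = ∏ λ_{k_l}`. -/
def lamProd (lam : ℕ → ℝ) (k : Fin d → ℕ) : ℝ := ∏ l, lam (k l)

/-- The algorithm `A*_{n,d} f = ∑_{v=1}^n ⟨f, ξ_{ψ(v)}⟩ S_d ξ_{ψ(v)}` (here `v` starts at `0`). -/
def optAlgorithm (S : H →L[ℝ] G) (e : ℕ → H) (ψ : ℕ → Fin d → ℕ) (n : ℕ) :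
    symSubspace s I H → HilbertTensorPower d G := fun f =>
  ∑ v ∈ Finset.range n, inner ℝ f (xi s I e (ψ v)) • symProblem s I S (xi s I e (ψ v))

end Symmetrizer

/-- `(e i, lam i)`, `i ∈ ℕ`, are the eigenpairs of the positive semidefinite operator `W` in
non-increasing order: an orthonormal sequence of eigenvectors with non-increasing non-negative
eigenvalues that exhausts `W`, in the sense that `W` vanishes on the orthogonal complement (so that
every non-zero eigenvalue is listed with its full multiplicity). -/
structure IsEigenpairSequence {E : Type*} [NormedAddCommGroup E] [InnerProductSpace ℝ E]
    (W : E →L[ℝ] E) (e : ℕ → E) (lam : ℕ → ℝ) : Prop where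
  orthonormal : Orthonormal ℝ e
  eigen : ∀ i, W (e i) = lam i • e i
  antitone : Antitone lam
  nonneg : ∀ i, 0 ≤ lam i
  exhausts : ∀ x, (∀ i, inner ℝ (e i) x = 0) → W x = 0

/-! ### Algorithms and errors -/

section Algorithms

variable {F Y : Type*} [NormedAddCommGroup F] [NormedSpace ℝ F] [NormedAddCommGroup Y]
  [NormedSpace ℝ Y]

/-- Linear non-adaptive algorithms `f ↦ ∑ L_v(f) g_v` using `n` continuous linear functionals. -/
def linAlgorithms (F Y : Type*) [NormedAddCommGroup F] [NormedSpace ℝ F] [NormedAddCommGroup Y]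
    [NormedSpace ℝ Y] (n : ℕ) : Set (F → Y) :=
  {A | ∃ (L : Fin n → F →L[ℝ] ℝ) (g : Fin n → Y), ∀ f, A f = ∑ v, L v f • g v}

/-- Algorithms `φ ∘ N` with arbitrary `φ` and non-adaptive information `N` consisting of `n`
continuous, not necessarily linear, functionals. -/
def contAlgorithms (F Y : Type*) [NormedAddCommGroup F] (n : ℕ) : Set (F → Y) :=
  {A | ∃ (L : Fin n → F → ℝ) (φ : (Fin n → ℝ) → Y), (∀ v, Continuous (L v)) ∧
    ∀ f, A f = φ fun v => L v f}

/-- Algorithms `φ ∘ N` with arbitrary `φ` and adaptive information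
`N(f) = (y_1, …, y_n)`, `y_v = L_v(f; y_1, …, y_{v-1})`, where every
`L_v(· ; y_1, …, y_{v-1})` is a continuous linear functional. -/
def adaptAlgorithms (F Y : Type*) [NormedAddCommGroup F] [NormedSpace ℝ F] (n : ℕ) :
    Set (F → Y) :=
  {A | ∃ (L : (v : Fin n) → (Fin v → ℝ) → F →L[ℝ] ℝ) (N : F → Fin n → ℝ)
      (φ : (Fin n → ℝ) → Y),
    (∀ f v, N f v = L v (fun j : Fin v => N f (Fin.castLE v.isLt.le j)) f) ∧
    ∀ f, A f = φ (N f)}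

/-- The worst case error of `A` for `S` over the closed unit ball; it may be infinite. -/
def worstCaseError (S A : F → Y) : ENNReal :=
  ⨆ f ∈ Metric.closedBall (0 : F) 1, ENNReal.ofReal ‖A f - S f‖

/-- The minimal worst case error over a class of algorithms. -/
def minimalError (S : F → Y) (𝒜 : Set (F → Y)) : ENNReal :=
  ⨅ A ∈ 𝒜, worstCaseError S A

end Algorithms

end

/-! ### Degree theory on the Euclidean unit ball: continuous functionals and dimension. -/

section Degree

open MeasureTheory Metric Polynomial

/-! The (anti-)symmetrizer is a self-adjoint idempotent that commutes with `S ⊗ ⋯ ⊗ S` and its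
adjoint. Hence `W_d` leaves the range invariant, and the restricted problem has the spectral theory
of `W_d` cut down to that range. Tensors of eigenvectors are eigenvectors of `W_d`; projecting them
keeps the eigenvalue. Permuting the indices inside `I` changes the projection at most by a sign, and
in the antisymmetric case a repeated index kills it, so the sorted indices in `nabla` represent
everything. The squared norm of a projected tensor is the order of the stabilizer of its index
divided by the order of the permutation group, which gives the normalization of `xi`
(`orthonormal_xi`). No basis assumption is needed for `isEigenpairSequence_xi`: testing `W_d f`
against a simple tensor amounts to testing `f` against a tensor with factors in the range of `W_1`,
and that range lies in the closed span of the eigenvectors.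

The error formula holds for any bounded `T` with an eigenpair sequence of `T†T`. Truncating the
spectral expansion gives the upper bound (`worstCaseError_spectral`). Adaptive linear information is
fooled by a unit vector and its negative in the span of `n + 1` eigenvectors, on which all
information vanishes. For continuous nonlinear information, a too accurate algorithm would recover
the points of the `(n + 1)`-dimensional unit ball, up to an error below 1, from `n` continuous
functionals. After smoothing this yields a `C¹` map close to the identity that factors through
dimension `n` and is therefore singular everywhere. `exists_det_fderiv_ne_zero` excludes such a map:
a weighted Jacobian integral along the homotopy from the identity is polynomial in the time
parameter and constant for small times by change of variables, hence constant throughout.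

Compactness of `S` serves to order the products of eigenvalues: it makes the eigenvalues tend to
zero, so only finitely many products exceed a given positive level. -/

theorem exists_polynomial_eval_eq_setIntegral {X : Type*} [TopologicalSpace X] [T2Space X]
    [MeasurableSpace X] [BorelSpace X] (μ : Measure X) [IsFiniteMeasureOnCompacts μ] {K : Set X}
    (hK : IsCompact K) (P : (C(X, ℝ))[X]) :
    ∃ p : ℝ[X], ∀ t : ℝ, p.eval t = ∫ x in K, (P.eval (algebraMap ℝ C(X, ℝ) t)) x ∂μ := by
  refine ⟨∑ i ∈ P.support, monomial i (∫ x in K, P.coeff i x ∂μ), fun t => ?_⟩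
  rw [eval_finsetSum]
  simp only [eval_monomial]
  have h : ∀ x, (P.eval (algebraMap ℝ C(X, ℝ) t)) x = ∑ i ∈ P.support, P.coeff i x * t ^ i := by
    intro x
    rw [eval_eq_sum, Polynomial.sum, ContinuousMap.coe_sum, Finset.sum_apply]
    rfl
  simp only [h]
  rw [integral_finsetSum]
  · simp only [integral_mul_const]
  · intro i _
    exact (((P.coeff i).continuous.continuousOn.integrableOn_compact hK).mul_const _)

variable {m : ℕ}

local notation "𝔼" => EuclideanSpace ℝ (Fin m)

/-- The integrand is polynomial in `t` with coefficients continuous in `x`, because the weight is a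
polynomial in the squared norm and the determinant is a polynomial in the matrix entries.
Integrating coefficientwise keeps it polynomial. -/
theorem exists_polynomial_eval_eq_integral_det {h : 𝔼 → 𝔼} (hh : ContDiff ℝ 1 h) (k : ℕ) :
    ∃ p : ℝ[X], ∀ t : ℝ, p.eval t = ∫ x in closedBall (0 : 𝔼) 1,
      (1 - ‖x + t • h x‖ ^ 2 / 4) ^ k *
        (ContinuousLinearMap.id ℝ 𝔼 + t • fderiv ℝ h x).det := by
  let b := (EuclideanSpace.basisFun (Fin m) ℝ).toBasis
  let a : Fin m → Fin m → C(𝔼, ℝ) := fun i j =>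
    ⟨fun x => (fderiv ℝ h x (b j)) i, by
      have := hh.continuous_fderiv one_ne_zero
      fun_prop⟩
  let cx : Fin m → C(𝔼, ℝ) := fun i => ⟨fun x => x i, by fun_prop⟩
  let ch : Fin m → C(𝔼, ℝ) := fun i => ⟨fun x => h x i, by
    have := hh.continuous
    fun_prop⟩
  let M : Matrix (Fin m) (Fin m) (C(𝔼, ℝ))[X] := 1 + Matrix.of fun i j => X * C (a i j)
  let q : (C(𝔼, ℝ))[X] := 1 - C (algebraMap ℝ C(𝔼, ℝ) (1 / 4)) * ∑ i, (C (cx i) + X * C (ch i)) ^ 2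
  obtain ⟨p, hp⟩ := exists_polynomial_eval_eq_setIntegral (volume : Measure 𝔼)
    (isCompact_closedBall (0 : 𝔼) 1) (q ^ k * M.det)
  refine ⟨p, fun t => ?_⟩
  rw [hp]
  refine integral_congr_ae (Filter.Eventually.of_forall fun x => ?_)
  simp only [eval_mul, eval_pow, ContinuousMap.mul_apply, ContinuousMap.pow_apply]
  congr 1
  · congr 1
    simp only [q, cx, ch, eval_sub, eval_one, eval_mul, eval_C, eval_finsetSum, eval_pow, eval_add,
      eval_X, EuclideanSpace.norm_sq_eq]
    simp [ContinuousMap.coe_sum, Finset.sum_apply]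
    ring
  -- Evaluation at `t` and then at `x` is a ring homomorphism, so it commutes with the determinant.
  · let φ : (C(𝔼, ℝ))[X] →+* ℝ :=
      ((Pi.evalRingHom (fun _ : 𝔼 => ℝ) x).comp (ContinuousMap.coeFnRingHom)).comp
        (evalRingHom (algebraMap ℝ C(𝔼, ℝ) t))
    have h1 : (M.det.eval (algebraMap ℝ C(𝔼, ℝ) t)) x = φ M.det := rfl
    rw [h1, RingHom.map_det, ContinuousLinearMap.det, ← LinearMap.det_toMatrix b]
    congr 1
    ext i j
    have h2 : b.repr (b j) i = (1 : Matrix (Fin m) (Fin m) ℝ) i j := by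
      rw [Module.Basis.repr_self, Matrix.one_apply, Finsupp.single_apply]
      simp [eq_comm]
    have h3 : ∀ v : 𝔼, b.repr v i = v i := fun v => by simp [b]
    have h4 : φ ((1 : Matrix (Fin m) (Fin m) (C(𝔼, ℝ))[X]) i j) = (1 : Matrix _ _ ℝ) i j := by
      by_cases hij : i = j <;> simp [Matrix.one_apply, hij]
    have h5 : φ (X * C (a i j)) = t * (fderiv ℝ h x (b j)) i := by
      simp only [map_mul]
      congr 1
      · simp [φ]
      · simp [φ, a]
    rw [LinearMap.toMatrix_apply, RingHom.mapMatrix_apply, Matrix.map_apply]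
    simp only [M, Matrix.add_apply, Matrix.of_apply, map_add, h4, h5]
    simp only [ContinuousLinearMap.coe_coe, add_apply,
      ContinuousLinearMap.id_apply, smul_apply, map_add, map_smul,
      Finsupp.add_apply, Finsupp.smul_apply, h2, smul_eq_mul]
    rw [h3]


/-- A contractive perturbation of the identity is a bijection of the whole space. This one fixes
every point outside the ball, so it must map the ball onto itself. -/
theorem image_closedBall_add_of_lipschitz {E : Type*} [NormedAddCommGroup E] [NormedSpace ℝ E]
    [CompleteSpace E] {u : E → E} {c : NNReal} (hc : c < 1) (hu : LipschitzWith c u) {r : ℝ}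
    (hs : ∀ x, r < ‖x‖ → u x = 0) :
    Function.Injective (fun x => x + u x) ∧
      (fun x => x + u x) '' closedBall 0 r = closedBall 0 r := by
  have happ : ApproximatesLinearOn (fun x => x + u x)
      ((ContinuousLinearEquiv.refl ℝ E : E ≃L[ℝ] E) : E →L[ℝ] E) Set.univ c := by
    intro x _ y _
    have h1 : x + u x - (y + u y) - ((ContinuousLinearEquiv.refl ℝ E : E ≃L[ℝ] E) : E →L[ℝ] E)
        (x - y) = u x - u y := by
      simp
      abel
    rw [h1]
    exact hu.norm_sub_le x y
  have hc' : Subsingleton E ∨ c <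
      ‖((ContinuousLinearEquiv.refl ℝ E : E ≃L[ℝ] E).symm : E →L[ℝ] E)‖₊⁻¹ := by
    rcases subsingleton_or_nontrivial E with h | h
    · exact Or.inl h
    · right
      have : ‖((ContinuousLinearEquiv.refl ℝ E : E ≃L[ℝ] E).symm : E →L[ℝ] E)‖₊ = 1 := by
        have h2 : ‖ContinuousLinearMap.id ℝ E‖₊ = 1 := by
          ext
          exact ContinuousLinearMap.norm_id
        exact h2
      rwa [this, inv_one]
  have hinj : Function.Injective (fun x => x + u x) :=
    Set.injOn_univ.1 (happ.injOn hc')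
  have hsurj : Function.Surjective (fun x => x + u x) := happ.surjective hc'
  refine ⟨hinj, ?_⟩
  have hcompl : (fun x => x + u x) '' (closedBall 0 r)ᶜ = (closedBall 0 r)ᶜ := by
    have h1 : Set.EqOn (fun x => x + u x) id (closedBall 0 r)ᶜ := fun x hx => by
      have hx' : r < ‖x‖ := by simpa using hx
      simp [hs x hx']
    rw [h1.image_eq, Set.image_id]
  rw [Set.image_compl_eq ⟨hinj, hsurj⟩] at hcompl
  exact compl_injective hcompl

/-- With `t • h` in place of `h` this is a change of variables for small `t > 0`. It persists up to
`t = 1`, where `x + h x` need not be injective, because both sides are polynomial in `t`. -/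
theorem integral_comp_mul_det_eq {h : 𝔼 → 𝔼} (hh : ContDiff ℝ 1 h)
    (hs : ∀ x, 1 < ‖x‖ → h x = 0) (k : ℕ) :
    ∫ x in closedBall (0 : 𝔼) 1, (1 - ‖x + h x‖ ^ 2 / 4) ^ k *
        (ContinuousLinearMap.id ℝ 𝔼 + fderiv ℝ h x).det =
      ∫ x in closedBall (0 : 𝔼) 1, (1 - ‖x‖ ^ 2 / 4) ^ k := by
  obtain ⟨p, hp⟩ := exists_polynomial_eval_eq_integral_det hh k
  have hcs : HasCompactSupport h :=
    HasCompactSupport.intro (isCompact_closedBall (0 : 𝔼) 1) fun x hx => hs x (by simpa using hx)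
  obtain ⟨C, hC⟩ := hh.lipschitzWith_of_hasCompactSupport hcs one_ne_zero
  have hfd : ∀ x, ‖fderiv ℝ h x‖ ≤ C := fun x => norm_fderiv_le_of_lipschitz ℝ hC
  have hdet : ∀ᶠ A : 𝔼 →L[ℝ] 𝔼 in nhds 0, 0 < (ContinuousLinearMap.id ℝ 𝔼 + A).det := by
    have hcont : Continuous fun A : 𝔼 →L[ℝ] 𝔼 => (ContinuousLinearMap.id ℝ 𝔼 + A).det :=
      ContinuousLinearMap.continuous_det.comp (continuous_const.add continuous_id)
    refine hcont.continuousAt.eventually_const_lt (u := 0) ?_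
    simp [ContinuousLinearMap.det]
  obtain ⟨ε, hε, hdet⟩ := Metric.eventually_nhds_iff_ball.1 hdet
  -- The first bound keeps the Jacobian determinant positive, the second makes `t • h` a
  -- contraction; `C + 1` avoids division by zero.
  set t₀ : ℝ := min (ε / (C + 1)) (1 / (C + 1))
  have hC1 : (0 : ℝ) < C + 1 := by positivity
  have ht₀ : 0 < t₀ := lt_min (by positivity) (by positivity)
  have hconst : ∀ t ∈ Set.Ioo 0 t₀, p.eval t = p.eval 0 := by
    intro t ht
    have h1 : t * (C + 1) < ε := (lt_div_iff₀ hC1).1 (ht.2.trans_le (min_le_left _ _))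
    have h2 : t * (C + 1) < 1 := (lt_div_iff₀ hC1).1 (ht.2.trans_le (min_le_right _ _))
    have htC : t * C < t * (C + 1) := mul_lt_mul_of_pos_left (by linarith) ht.1
    have hlip : LipschitzWith (t.toNNReal * C) fun x => t • h x := by
      refine LipschitzWith.of_dist_le_mul fun x y => ?_
      rw [dist_smul₀, Real.norm_of_nonneg ht.1.le, NNReal.coe_mul,
        Real.coe_toNNReal t ht.1.le, mul_assoc]
      exact mul_le_mul_of_nonneg_left (hC.dist_le_mul x y) ht.1.le
    obtain ⟨hinj, himg⟩ := image_closedBall_add_of_lipschitz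
      (show t.toNNReal * C < 1 from by
        rw [← NNReal.coe_lt_coe]
        simpa [Real.coe_toNNReal t ht.1.le] using htC.trans h2)
      hlip (r := 1) fun x hx => by rw [hs x hx, smul_zero]
    have hder : ∀ x ∈ closedBall (0 : 𝔼) 1, HasFDerivWithinAt (fun x => x + t • h x)
        (ContinuousLinearMap.id ℝ 𝔼 + t • fderiv ℝ h x) (closedBall 0 1) x := fun x _ =>
      ((hasFDerivAt_id x).add
        ((hh.differentiable one_ne_zero x).hasFDerivAt.const_smul t)).hasFDerivWithinAt
    have hcv := integral_image_eq_integral_abs_det_fderiv_smul volume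
      (isClosed_closedBall (x := (0 : 𝔼)) (ε := 1)).measurableSet hder hinj.injOn
      fun x => (1 - ‖x‖ ^ 2 / 4) ^ k
    rw [himg] at hcv
    rw [hp, hp]
    have h0 : ∀ x : 𝔼, (1 - ‖x + (0 : ℝ) • h x‖ ^ 2 / 4) ^ k *
        (ContinuousLinearMap.id ℝ 𝔼 + (0 : ℝ) • fderiv ℝ h x).det = (1 - ‖x‖ ^ 2 / 4) ^ k := by
      intro x
      simp [ContinuousLinearMap.det]
    simp only [h0]
    rw [hcv]
    refine integral_congr_ae (Filter.Eventually.of_forall fun x => ?_)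
    have hpos : 0 < (ContinuousLinearMap.id ℝ 𝔼 + t • fderiv ℝ h x).det := by
      refine hdet _ ?_
      rw [mem_ball_zero_iff, norm_smul, Real.norm_of_nonneg ht.1.le]
      exact ((mul_le_mul_of_nonneg_left (hfd x) ht.1.le).trans_lt htC).trans h1
    simp only [abs_of_pos hpos, smul_eq_mul]
    ring
  have hpC : p = Polynomial.C (p.eval 0) := by
    refine Polynomial.eq_of_infinite_eval_eq _ _ ((Set.Ioo_infinite ht₀).mono fun t ht => ?_)
    simp [hconst t ht]
  have h01 : p.eval 1 = p.eval 0 := by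
    rw [hpC, eval_C, eval_C]
  rw [hp, hp] at h01
  simpa [ContinuousLinearMap.det] using h01

/-- A `C¹` map that moves every point of the unit ball by at most `r < 1` is not everywhere
singular. -/
theorem exists_det_fderiv_ne_zero {g : 𝔼 → 𝔼} (hg : ContDiff ℝ 1 g) {r : ℝ} (hr : r < 1)
    (hgr : ∀ x ∈ closedBall (0 : 𝔼) 1, ‖g x - x‖ ≤ r) : ∃ x, (fderiv ℝ g x).det ≠ 0 := by
  by_contra! hdet
  have hr0 : 0 ≤ r := (norm_nonneg _).trans (hgr 0 (by simp))
  -- The cutoff equals 1 on the ball of radius `ρ`, with `r < ρ < 1`. Since `h` moves points by at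
  -- most `r`, a point sent into the ball of radius `η = ρ - r` started where `x + h x = g x`, and
  -- there the determinant vanishes.
  set ρ : ℝ := (1 + r) / 2
  have hρ1 : ρ < 1 := by simp only [ρ]; linarith
  have hρ0 : 0 < ρ := by simp only [ρ]; linarith
  let χ : ContDiffBump (0 : 𝔼) := ⟨ρ, 1, hρ0, hρ1⟩
  let h : 𝔼 → 𝔼 := fun x => χ x • (g x - x)
  have hh : ContDiff ℝ 1 h := χ.contDiff.smul (hg.sub contDiff_id)
  have hs : ∀ x, 1 < ‖x‖ → h x = 0 := fun x hx => by
    have : χ x = 0 := χ.zero_of_le_dist (by simpa using hx.le)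
    simp [h, this]
  have hhr : ∀ x ∈ closedBall (0 : 𝔼) 1, ‖h x‖ ≤ r := fun x hx => by
    rw [norm_smul, Real.norm_of_nonneg χ.nonneg]
    exact (mul_le_of_le_one_left (norm_nonneg _) χ.le_one).trans (hgr x hx)
  set η : ℝ := ρ - r
  have hη : 0 < η := by simp only [η, ρ]; linarith
  have hη1 : η < 1 := by simp only [η]; linarith
  have hsing : ∀ x ∈ closedBall (0 : 𝔼) 1, ‖x + h x‖ < η →
      (ContinuousLinearMap.id ℝ 𝔼 + fderiv ℝ h x).det = 0 := by
    intro x hx hxη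
    have hxρ : ‖x‖ < ρ := by
      have h1 : ‖x‖ ≤ ‖x + h x‖ + ‖h x‖ := by
        simpa using norm_sub_le (x + h x) (h x)
      have h2 := hhr x hx
      simp only [η] at hxη
      linarith
    have hev : h =ᶠ[nhds x] fun y => g y - y := by
      filter_upwards [isOpen_ball.mem_nhds (show x ∈ ball (0 : 𝔼) ρ by simpa using hxρ)] with y hy
      have : χ y = 1 := χ.one_of_mem_closedBall (ball_subset_closedBall hy)
      simp [h, this]
    have hd : fderiv ℝ h x = fderiv ℝ g x - ContinuousLinearMap.id ℝ 𝔼 := by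
      rw [hev.fderiv_eq]
      exact ((hg.differentiable one_ne_zero x).hasFDerivAt.sub (hasFDerivAt_id x)).fderiv
    rw [hd, add_sub_cancel]
    exact hdet x
  have hcontdet : Continuous fun x => (ContinuousLinearMap.id ℝ 𝔼 + fderiv ℝ h x).det :=
    ContinuousLinearMap.continuous_det.comp
      (continuous_const.add (hh.continuous_fderiv one_ne_zero))
  obtain ⟨D, hD⟩ := (isCompact_closedBall (0 : 𝔼) 1).exists_bound_of_continuousOn
    hcontdet.continuousOn
  -- As `k` grows the weight concentrates at the origin. The perturbed integral sees only values
  -- with norm at least `η`, where the weight is at most `a ^ k`; the unperturbed one has weight at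
  -- least `b ^ k` on the ball of radius `η / 2`. Since `a < b`, they cannot agree for all `k`.
  set a : ℝ := 1 - η ^ 2 / 4
  set b : ℝ := 1 - (η / 2) ^ 2 / 4
  have hab : a < b := by simp only [a, b]; nlinarith
  have ha : 0 < a := by simp only [a]; nlinarith
  set V : ℝ := volume.real (closedBall (0 : 𝔼) 1)
  set v : ℝ := volume.real (closedBall (0 : 𝔼) (η / 2))
  have hv : 0 < v := by
    refine ENNReal.toReal_pos (measure_closedBall_pos volume _ (by positivity)).ne' ?_
    exact (isCompact_closedBall _ _).measure_lt_top.ne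
  have hupper : ∀ k : ℕ, ∫ x in closedBall (0 : 𝔼) 1, (1 - ‖x + h x‖ ^ 2 / 4) ^ k *
      (ContinuousLinearMap.id ℝ 𝔼 + fderiv ℝ h x).det ≤ a ^ k * D * V := by
    intro k
    refine (Real.le_norm_self _).trans
      (norm_setIntegral_le_of_norm_le_const (isCompact_closedBall _ _).measure_lt_top ?_)
    intro x hx
    by_cases hxη : ‖x + h x‖ < η
    · rw [hsing x hx hxη]
      have := (norm_nonneg _).trans (hD x hx)
      simp only [mul_zero, norm_zero]
      positivity
    · have h2 : ‖x + h x‖ ≤ 2 := by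
        have h3 := hhr x hx
        have h4 : ‖x‖ ≤ 1 := by simpa using hx
        linarith [norm_add_le x (h x)]
      have h0 : 0 ≤ 1 - ‖x + h x‖ ^ 2 / 4 := by nlinarith [norm_nonneg (x + h x)]
      have h1 : 1 - ‖x + h x‖ ^ 2 / 4 ≤ a := by
        simp only [a]
        nlinarith
      rw [norm_mul, norm_pow, Real.norm_of_nonneg h0]
      exact mul_le_mul (pow_le_pow_left₀ h0 h1 k) (hD x hx) (norm_nonneg _) (by positivity)
  have hlower : ∀ k : ℕ, b ^ k * v ≤ ∫ x in closedBall (0 : 𝔼) 1, (1 - ‖x‖ ^ 2 / 4) ^ k := by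
    intro k
    have hint : IntegrableOn (fun x : 𝔼 => (1 - ‖x‖ ^ 2 / 4) ^ k) (closedBall (0 : 𝔼) 1) :=
      ContinuousOn.integrableOn_compact (isCompact_closedBall _ _) (by fun_prop)
    have hsub : closedBall (0 : 𝔼) (η / 2) ⊆ closedBall 0 1 :=
      closedBall_subset_closedBall (by linarith)
    calc b ^ k * v = ∫ _ in closedBall (0 : 𝔼) (η / 2), b ^ k := by
          rw [setIntegral_const, smul_eq_mul, mul_comm]
      _ ≤ ∫ x in closedBall (0 : 𝔼) (η / 2), (1 - ‖x‖ ^ 2 / 4) ^ k := by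
          refine setIntegral_mono_on ?_ (hint.mono_set hsub) isClosed_closedBall.measurableSet ?_
          · exact continuousOn_const.integrableOn_compact (isCompact_closedBall _ _)
          · intro x hx
            have hx' : ‖x‖ ≤ η / 2 := by simpa using hx
            refine pow_le_pow_left₀ (ha.trans hab).le ?_ k
            simp only [b]
            nlinarith [norm_nonneg x]
      _ ≤ _ := by
          refine setIntegral_mono_set hint ?_ hsub.eventuallyLE
          refine (ae_restrict_iff' isClosed_closedBall.measurableSet).2
            (Filter.Eventually.of_forall fun x hx => ?_)
          have hx' : ‖x‖ ≤ 1 := by simpa using hx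
          refine pow_nonneg ?_ k
          nlinarith [norm_nonneg x]
  have hkey : ∀ k : ℕ, v ≤ (a / b) ^ k * (D * V) := by
    intro k
    have h1 := (hlower k).trans ((integral_comp_mul_det_eq hh hs k).symm.le.trans (hupper k))
    rw [div_pow, div_mul_eq_mul_div, le_div_iff₀ (pow_pos (ha.trans hab) k)]
    linarith
  have hlim : Filter.Tendsto (fun k : ℕ => (a / b) ^ k * (D * V)) Filter.atTop (nhds 0) := by
    have := (tendsto_pow_atTop_nhds_zero_of_lt_one (div_pos ha (ha.trans hab)).le
      ((div_lt_one (ha.trans hab)).2 hab)).mul_const (D * V)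
    rwa [zero_mul] at this
  exact absurd (ge_of_tendsto' hlim hkey) (not_le.2 hv)

/-- Information consisting of `n` continuous functionals does not determine the points of the unit
ball of an `(n + 1)`-dimensional Euclidean space up to an error `r < 1`. -/
theorem exists_lt_norm_sub_of_continuous {n : ℕ} {N : EuclideanSpace ℝ (Fin (n + 1)) → Fin n → ℝ}
    (hN : Continuous N) (φ : (Fin n → ℝ) → EuclideanSpace ℝ (Fin (n + 1))) {r : ℝ} (hr : r < 1) :
    ∃ x ∈ closedBall (0 : EuclideanSpace ℝ (Fin (n + 1))) 1, r < ‖φ (N x) - x‖ := by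
  by_contra! hφ
  -- Two smoothing steps lose accuracy: replacing `φ` costs `r₁ - r`, replacing `N` costs `r₂ - r₁`.
  obtain ⟨r₁, hr₁, hr₁'⟩ := exists_between hr
  obtain ⟨r₂, hr₂, hr₂'⟩ := exists_between hr₁'
  have hB : IsCompact (closedBall (0 : EuclideanSpace ℝ (Fin (n + 1))) 1) :=
    isCompact_closedBall _ _
  -- The map `φ` is arbitrary, but its value at `u` stays admissible with tolerance `r₁` for nearby
  -- information, by compactness of the ball. Admissible values form convex sets, so a partition of
  -- unity glues them to a `C¹` map.
  obtain ⟨ψ, hψ⟩ := exists_contMDiffMap_forall_mem_convex_of_local_const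
    (n := 1) (modelWithCornersSelf ℝ (Fin n → ℝ))
    (t := fun u => {c | ∀ x ∈ closedBall (0 : EuclideanSpace ℝ (Fin (n + 1))) 1, N x = u →
      c ∈ ball x r₁})
    (fun u c hc c' hc' a b ha hb hab x hx hxu =>
      convex_ball x r₁ (hc x hx hxu) (hc' x hx hxu) ha hb hab)
    (fun u => by
      refine ⟨φ u, ?_⟩
      have hcl : IsClosed (N '' (closedBall 0 1 ∩ {x | r₁ ≤ ‖φ u - x‖})) :=
        ((hB.inter_right (isClosed_le continuous_const (by fun_prop))).image hN).isClosed
      have hu : u ∉ N '' (closedBall 0 1 ∩ {x | r₁ ≤ ‖φ u - x‖}) := by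
        rintro ⟨x, ⟨hx, hx'⟩, rfl⟩
        exact absurd (hφ x hx) (not_le.2 (hr₁.trans_le hx'))
      filter_upwards [hcl.isOpen_compl.mem_nhds hu] with y hy x hx hxy
      rw [mem_ball, dist_eq_norm]
      by_contra! hc
      exact hy ⟨x, ⟨hx, hc⟩, hxy⟩)
  have hψc : ContDiff ℝ 1 ψ := ψ.contMDiff.contDiff
  have hunif := (hB.image hN).uniformContinuousAt_of_continuousAt ψ
    (fun a _ => hψc.continuous.continuousAt) (Metric.dist_mem_uniformity (sub_pos.2 hr₂))
  obtain ⟨δ, hδ, hδ'⟩ := Metric.mem_uniformity_dist.1 hunif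
  obtain ⟨N', hN', hNN', -⟩ := hN.exists_contDiff_approx 1 (ε := fun _ => δ) continuous_const
    fun _ => hδ
  have hN'1 : ContDiff ℝ 1 N' := hN'
  obtain ⟨x, hx⟩ := exists_det_fderiv_ne_zero (hψc.comp hN'1) hr₂' fun x hx => by
    have h1 : dist (ψ (N x)) (ψ (N' x)) < r₂ - r₁ :=
      hδ' (by rw [dist_comm]; exact hNN' x) (Set.mem_image_of_mem N hx)
    have h2 : dist (ψ (N x)) x < r₁ := hψ (N x) x hx rfl
    rw [← dist_eq_norm, Function.comp_apply]
    have := dist_triangle_left (ψ (N' x)) x (ψ (N x))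
    linarith
  refine hx ?_
  rw [fderiv_comp x (hψc.differentiable one_ne_zero _) (hN'1.differentiable one_ne_zero _)]
  -- The derivative factors through dimension `n < n + 1`.
  refine LinearMap.det_eq_zero_iff_ker_ne_bot.2 fun hker => ?_
  refine LinearMap.ker_ne_bot_of_finrank_lt (f := (fderiv ℝ N' x).toLinearMap) (by simp) ?_
  rw [eq_bot_iff, ← hker]
  exact LinearMap.ker_le_ker_comp _ _

end Degree

/-! ### Worst case optimality of spectral truncation for a general operator. -/

namespace IsEigenpairSequence

theorem exists_bound_of_worstCaseError_lt {F Y : Type*}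
    [NormedAddCommGroup F] [NormedAddCommGroup Y] {S A : F → Y} {c : ℝ}
    (h : worstCaseError S A < ENNReal.ofReal c) :
    ∃ r, 0 ≤ r ∧ r < c ∧ ∀ f ∈ Metric.closedBall (0 : F) 1, ‖A f - S f‖ ≤ r := by
  refine ⟨(worstCaseError S A).toReal, ENNReal.toReal_nonneg, ?_, fun f hf => ?_⟩
  · exact (ENNReal.lt_ofReal_iff_toReal_lt (h.ne_top)).1 h
  · rw [← ENNReal.ofReal_le_iff_le_toReal h.ne_top]
    exact le_iSup₂ (f := fun f (_ : f ∈ Metric.closedBall (0 : F) 1) =>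
      ENNReal.ofReal ‖A f - S f‖) f hf

section Truncation

variable {F : Type*} [NormedAddCommGroup F] [InnerProductSpace ℝ F] {e : ℕ → F}

/-- The orthogonal projection to the span of the first `n` eigenvectors. -/
noncomputable def truncation (e : ℕ → F) (n : ℕ) : F →L[ℝ] F :=
  ∑ i ∈ Finset.range n, (innerSL ℝ (e i)).smulRight (e i)

theorem truncation_apply (e : ℕ → F) (n : ℕ) (x : F) :
    truncation e n x = ∑ i ∈ Finset.range n, inner ℝ (e i) x • e i := by
  simp [truncation]

theorem inner_truncation (he : Orthonormal ℝ e) (n i : ℕ) (x : F) :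
    inner ℝ (e i) (truncation e n x) = if i < n then inner ℝ (e i) x else 0 := by
  rw [truncation_apply]
  split_ifs with h
  · exact he.inner_right_sum _ (Finset.mem_range.2 h)
  · rw [inner_sum]
    refine Finset.sum_eq_zero fun j hj => ?_
    have hij : i ≠ j := fun hij => h (hij ▸ Finset.mem_range.1 hj)
    rw [real_inner_smul_right, he.2 hij, mul_zero]

theorem norm_sub_truncation_le (he : Orthonormal ℝ e) (n : ℕ) (x : F) :
    ‖x - truncation e n x‖ ≤ ‖x‖ := by
  have horth : inner ℝ (truncation e n x) (x - truncation e n x) = 0 := by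
    nth_rewrite 1 [truncation_apply]
    rw [sum_inner]
    refine Finset.sum_eq_zero fun i hi => ?_
    rw [real_inner_smul_left, inner_sub_right, inner_truncation he, if_pos (Finset.mem_range.1 hi)]
    ring
  have h := norm_add_sq_eq_norm_sq_add_norm_sq_of_inner_eq_zero _ _ horth
  rw [add_sub_cancel] at h
  nlinarith [norm_nonneg x, norm_nonneg (x - truncation e n x), norm_nonneg (truncation e n x)]

end Truncation

variable {F Y : Type*} [NormedAddCommGroup F] [InnerProductSpace ℝ F] [CompleteSpace F]
  [NormedAddCommGroup Y] [InnerProductSpace ℝ Y] [CompleteSpace Y] {T : F →L[ℝ] Y}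
  {e : ℕ → F} {lam : ℕ → ℝ}

theorem inner_apply (he : IsEigenpairSequence (T.adjoint.comp T) e lam) (i : ℕ) (x : F) :
    inner ℝ (T (e i)) (T x) = lam i * inner ℝ (e i) x := by
  rw [← ContinuousLinearMap.adjoint_inner_left, ← ContinuousLinearMap.comp_apply, he.eigen,
    real_inner_smul_left]

theorem norm_apply_sum_sq (he : IsEigenpairSequence (T.adjoint.comp T) e lam) (s : Finset ℕ)
    (c : ℕ → ℝ) : ‖T (∑ i ∈ s, c i • e i)‖ ^ 2 = ∑ i ∈ s, lam i * c i ^ 2 := by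
  rw [← real_inner_self_eq_norm_sq]
  nth_rewrite 1 [map_sum]
  rw [sum_inner]
  refine Finset.sum_congr rfl fun i hi => ?_
  rw [map_smul, real_inner_smul_left, he.inner_apply, he.orthonormal.inner_right_sum c hi]
  ring

theorem norm_sum_sq (he : IsEigenpairSequence (T.adjoint.comp T) e lam) (s : Finset ℕ)
    (c : ℕ → ℝ) : ‖∑ i ∈ s, c i • e i‖ ^ 2 = ∑ i ∈ s, c i ^ 2 := by
  rw [← real_inner_self_eq_norm_sq, he.orthonormal.inner_sum]
  simp [sq]

theorem apply_eq_zero (he : IsEigenpairSequence (T.adjoint.comp T) e lam) {x : F}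
    (hx : ∀ i, inner ℝ (e i) x = 0) : T x = 0 := by
  rw [← norm_eq_zero, ← sq_eq_zero_iff, ← real_inner_self_eq_norm_sq,
    ← ContinuousLinearMap.adjoint_inner_left, ← ContinuousLinearMap.comp_apply, he.exhausts x hx,
    inner_zero_left]

/-- On finite combinations of the `e i` the operator is diagonal up to isometry and only indices `i
≥ n` survive. The bound extends to the closed span, and `T` vanishes on its orthogonal complement.
-/
theorem norm_apply_sub_truncation_le (he : IsEigenpairSequence (T.adjoint.comp T) e lam) (n : ℕ)
    (x : F) : ‖T (x - truncation e n x)‖ ≤ √(lam n) * ‖x‖ := by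
  set K := (Submodule.span ℝ (Set.range e)).topologicalClosure
  have hspan : ∀ y ∈ Submodule.span ℝ (Set.range e),
      ‖T (y - truncation e n y)‖ ≤ √(lam n) * ‖y‖ := by
    intro y hy
    refine le_trans ?_ (mul_le_mul_of_nonneg_left (norm_sub_truncation_le he.orthonormal n y)
      (Real.sqrt_nonneg _))
    obtain ⟨c, rfl⟩ := Finsupp.mem_span_range_iff_exists_finsupp.1 hy
    have hsub : (c.sum fun i a => a • e i) - truncation e n (c.sum fun i a => a • e i) =
        ∑ i ∈ c.support with ¬ i < n, c i • e i := by
      have h1 : truncation e n (c.sum fun i a => a • e i) =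
          ∑ i ∈ c.support with i < n, c i • e i := by
        rw [Finsupp.sum, map_sum, Finset.sum_filter]
        refine Finset.sum_congr rfl fun i _ => ?_
        rw [map_smul, truncation_apply]
        split_ifs with h
        · rw [Finset.sum_eq_single_of_mem i (Finset.mem_range.2 h)]
          · simp [he.orthonormal.1 i]
          · intro j _ hj
            rw [he.orthonormal.2 hj, zero_smul]
        · rw [Finset.sum_eq_zero, smul_zero]
          intro j hj
          have hij : j ≠ i := fun hij => h (hij ▸ Finset.mem_range.1 hj)
          rw [he.orthonormal.2 hij, zero_smul]
      rw [h1, Finsupp.sum, ← Finset.sum_filter_add_sum_filter_not c.support (fun i => i < n),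
        add_sub_cancel_left]
    rw [hsub]
    refine le_of_sq_le_sq ?_ (by positivity)
    rw [mul_pow, Real.sq_sqrt (he.nonneg n), he.norm_apply_sum_sq, he.norm_sum_sq, Finset.mul_sum]
    refine Finset.sum_le_sum fun i hi => mul_le_mul_of_nonneg_right (he.antitone ?_) (sq_nonneg _)
    simpa using (Finset.mem_filter.1 hi).2
  have hK : ∀ y ∈ K, ‖T (y - truncation e n y)‖ ≤ √(lam n) * ‖y‖ := by
    intro y hy
    have hcl : IsClosed {y | ‖T (y - truncation e n y)‖ ≤ √(lam n) * ‖y‖} :=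
      isClosed_le (by fun_prop) (by fun_prop)
    exact closure_minimal hspan hcl hy
  have : CompleteSpace K := (Submodule.isClosed_topologicalClosure _).completeSpace_coe
  obtain ⟨y, hy, z, hz, rfl⟩ := K.exists_add_mem_mem_orthogonal x
  have hz' : ∀ i, inner ℝ (e i) z = 0 := fun i =>
    hz _ (Submodule.le_topologicalClosure _ (Submodule.subset_span ⟨i, rfl⟩))
  have h1 : truncation e n (y + z) = truncation e n y := by
    rw [map_add, truncation_apply e n z, Finset.sum_eq_zero fun i _ => by rw [hz', zero_smul],
      add_zero]
  have h2 : T (y + z - truncation e n (y + z)) = T (y - truncation e n y) := by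
    rw [h1, add_sub_right_comm, map_add, he.apply_eq_zero hz', add_zero]
  have h3 : ‖y‖ ≤ ‖y + z‖ := by
    have h := norm_add_sq_eq_norm_sq_add_norm_sq_of_inner_eq_zero y z (hz y hy)
    nlinarith [norm_nonneg y, norm_nonneg (y + z), norm_nonneg z]
  rw [h2]
  exact (hK y hy).trans (mul_le_mul_of_nonneg_left h3 (Real.sqrt_nonneg _))

theorem norm_apply (he : IsEigenpairSequence (T.adjoint.comp T) e lam) (n : ℕ) :
    ‖T (e n)‖ = √(lam n) := by
  have h := he.norm_apply_sum_sq {n} 1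
  simp only [Finset.sum_singleton, Pi.one_apply, one_smul, one_pow, mul_one] at h
  rw [← h, Real.sqrt_sq (norm_nonneg _)]

theorem worstCaseError_spectral (he : IsEigenpairSequence (T.adjoint.comp T) e lam) (n : ℕ) :
    worstCaseError T (fun f => ∑ v ∈ Finset.range n, inner ℝ f (e v) • T (e v)) =
      ENNReal.ofReal √(lam n) := by
  have hA : ∀ f, ∑ v ∈ Finset.range n, inner ℝ f (e v) • T (e v) = T (truncation e n f) := by
    intro f
    simp [truncation_apply, real_inner_comm f]
  have herr : ∀ f, ‖∑ v ∈ Finset.range n, inner ℝ f (e v) • T (e v) - T f‖ =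
      ‖T (f - truncation e n f)‖ := by
    intro f
    rw [hA, norm_sub_rev, map_sub]
  refine le_antisymm (iSup₂_le fun f hf => ENNReal.ofReal_le_ofReal ?_) ?_
  · rw [herr]
    refine (he.norm_apply_sub_truncation_le n f).trans
      (mul_le_of_le_one_right (Real.sqrt_nonneg _) ?_)
    simpa using hf
  -- With indices starting at 0, `e n` is the first eigenvector that the algorithm misses, and it
  -- attains the bound.
  · have h1 : e n ∈ Metric.closedBall (0 : F) 1 := by simp [he.orthonormal.1 n]
    refine le_trans (le_of_eq ?_) (le_iSup₂ (f := fun f (_ : f ∈ Metric.closedBall (0 : F) 1) =>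
      ENNReal.ofReal ‖∑ v ∈ Finset.range n, inner ℝ f (e v) • T (e v) - T f‖) (e n) h1)
    have h2 : truncation e n (e n) = 0 := by
      rw [truncation_apply]
      refine Finset.sum_eq_zero fun i hi => ?_
      rw [he.orthonormal.2 (Finset.mem_range.1 hi).ne, zero_smul]
    rw [herr, h2, sub_zero, he.norm_apply]

/-- Adaptivity does not help: along the branch where all answers are zero the information is linear
and fixed, so `n` functionals have a common zero in the span of `n + 1` eigenvectors. -/
theorem le_worstCaseError_of_mem_adaptAlgorithms
    (he : IsEigenpairSequence (T.adjoint.comp T) e lam) {n : ℕ} {A : F → Y}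
    (hA : A ∈ adaptAlgorithms F Y n) : ENNReal.ofReal √(lam n) ≤ worstCaseError T A := by
  by_contra! hlt
  obtain ⟨r, hr0, hr, hAr⟩ := exists_bound_of_worstCaseError_lt hlt
  obtain ⟨L, N, φ, hN, hA⟩ := hA
  have hzero : ∀ f, (∀ v, L v 0 f = 0) → N f = 0 := by
    intro f hf
    have h : ∀ k (hk : k < n), N f ⟨k, hk⟩ = 0 := by
      intro k
      induction k using Nat.strong_induction_on with
      | _ k ih =>
        intro hk
        rw [hN f ⟨k, hk⟩]
        have h0 : (fun j : Fin (⟨k, hk⟩ : Fin n) => N f (Fin.castLE hk.le j)) = 0 := by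
          funext j
          exact ih j j.2 (j.2.trans hk)
        exact (congrArg (fun y => L ⟨k, hk⟩ y f) h0).trans (hf _)
    funext v
    exact h v v.2
  let J : (Fin (n + 1) → ℝ) →ₗ[ℝ] F := Fintype.linearCombination ℝ fun i : Fin (n + 1) => e i
  let Λ : (Fin (n + 1) → ℝ) →ₗ[ℝ] (Fin n → ℝ) := LinearMap.pi fun v => (L v 0).toLinearMap.comp J
  obtain ⟨c, hc, hc0⟩ := (Submodule.ne_bot_iff _).1
    (LinearMap.ker_ne_bot_of_finrank_lt (f := Λ) (by simp))
  let c' : ℕ → ℝ := fun i => if h : i < n + 1 then c ⟨i, h⟩ else 0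
  have hJ : J c = ∑ i ∈ Finset.range (n + 1), c' i • e i := by
    rw [Finset.sum_range]
    simp only [J, c', Fintype.linearCombination_apply, Fin.is_lt, dite_true, Fin.eta]
  have hTJ : lam n * ‖J c‖ ^ 2 ≤ ‖T (J c)‖ ^ 2 := by
    rw [hJ, he.norm_apply_sum_sq, he.norm_sum_sq, Finset.mul_sum]
    refine Finset.sum_le_sum fun i hi => mul_le_mul_of_nonneg_right (he.antitone ?_) (sq_nonneg _)
    exact Nat.lt_succ_iff.1 (Finset.mem_range.1 hi)
  have hJ0 : J c ≠ 0 := by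
    have hli : LinearIndependent ℝ fun i : Fin (n + 1) => e i :=
      he.orthonormal.linearIndependent.comp _ Fin.val_injective
    intro h
    exact hc0 (funext fun i => Fintype.linearIndependent_iff.1 hli c
      (by simpa [J, Fintype.linearCombination_apply] using h) i)
  have hnorm : 0 < ‖J c‖ := norm_pos_iff.2 hJ0
  set f : F := ‖J c‖⁻¹ • J c
  have hf1 : ‖f‖ = 1 := by
    rw [norm_smul, norm_inv, norm_norm, inv_mul_cancel₀ hnorm.ne']
  have hTf : √(lam n) ≤ ‖T f‖ := by
    refine Real.sqrt_le_iff.2 ⟨norm_nonneg _, ?_⟩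
    rw [map_smul, norm_smul, norm_inv, norm_norm, mul_pow, inv_pow, inv_mul_eq_div,
      le_div_iff₀ (by positivity)]
    exact hTJ
  have hLf : ∀ v, L v 0 f = 0 := by
    intro v
    have h : L v 0 (J c) = 0 := congrFun (LinearMap.mem_ker.1 hc) v
    rw [map_smul, h, smul_zero]
  have hNf := hzero f hLf
  have hNf' := hzero (-f) fun v => by rw [map_neg, hLf, neg_zero]
  have h1 := hAr f (by simp [hf1])
  have h2 := hAr (-f) (by simp [hf1])
  rw [hA, hNf] at h1
  rw [hA, hNf', map_neg, sub_neg_eq_add] at h2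
  -- Both `f` and `-f` receive the answer `φ 0`, which cannot be within `r < ‖T f‖` of both `T f`
  -- and `-T f`.
  have h3 : (2 : ℝ) * ‖T f‖ ≤ ‖φ 0 + T f‖ + ‖φ 0 - T f‖ := by
    have h4 : φ 0 + T f - (φ 0 - T f) = (2 : ℝ) • T f := by
      rw [two_smul]
      abel
    have h5 := norm_sub_le (φ 0 + T f) (φ 0 - T f)
    rwa [h4, norm_smul, Real.norm_two] at h5
  linarith

/-- An error below `√(lam n)` would allow the coordinates in the span of the first `n + 1`
eigenvectors to be read off from `n` continuous functionals, with Euclidean error below 1. -/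
theorem le_worstCaseError_of_mem_contAlgorithms
    (he : IsEigenpairSequence (T.adjoint.comp T) e lam) {n : ℕ} {A : F → Y}
    (hA : A ∈ contAlgorithms F Y n) : ENNReal.ofReal √(lam n) ≤ worstCaseError T A := by
  by_contra! hlt
  obtain ⟨r, hr0, hr, hAr⟩ := exists_bound_of_worstCaseError_lt hlt
  obtain ⟨L, φ, hL, hA⟩ := hA
  have hn : 0 < lam n := Real.sqrt_pos.1 (hr0.trans_lt hr)
  have hle : ∀ i : Fin (n + 1), lam n ≤ lam i := fun i => he.antitone (Nat.lt_succ_iff.1 i.2)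
  have hpos : ∀ i : Fin (n + 1), 0 < lam i := fun i => hn.trans_le (hle i)
  have heF : Orthonormal ℝ fun i : Fin (n + 1) => e i :=
    he.orthonormal.comp _ Fin.val_injective
  let J : EuclideanSpace ℝ (Fin (n + 1)) → F := fun x => ∑ i, x i • e i
  have hJ : Continuous J := by fun_prop
  have hJn : ∀ x, ‖J x‖ = ‖x‖ := by
    intro x
    rw [← sq_eq_sq₀ (norm_nonneg _) (norm_nonneg _), ← real_inner_self_eq_norm_sq, heF.inner_sum,
      EuclideanSpace.norm_sq_eq]
    simp [sq]
  have hη : Orthonormal ℝ fun i : Fin (n + 1) => (√(lam i))⁻¹ • T (e i) := by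
    constructor
    · intro i
      rw [norm_smul, he.norm_apply, norm_inv, Real.norm_of_nonneg (Real.sqrt_nonneg _),
        inv_mul_cancel₀ (Real.sqrt_pos.2 (hpos i)).ne']
    · intro i j hij
      have h0 : inner ℝ (e i) (e j) = 0 := heF.2 hij
      simp only [real_inner_smul_left, real_inner_smul_right, he.inner_apply, h0, mul_zero]
  -- The decoder inverts `T` coordinatewise: `inner ℝ (T (e i)) (T (J x))` is `lam i * x i`.
  obtain ⟨x, hx, hxr⟩ := exists_lt_norm_sub_of_continuous (N := fun x v => L v (J x))
    (continuous_pi fun v => (hL v).comp hJ)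
    (fun u => WithLp.toLp 2 fun i => inner ℝ (T (e i)) (φ u) / lam i)
    (r := r / √(lam n)) ((div_lt_one (Real.sqrt_pos.2 hn)).2 hr)
  refine absurd hxr (not_lt.2 ?_)
  rw [← sq_le_sq₀ (norm_nonneg _) (by positivity), div_pow, Real.sq_sqrt hn.le,
    EuclideanSpace.norm_sq_eq, le_div_iff₀ hn]
  set z : Y := φ (fun v => L v (J x)) - T (J x)
  have hz : ‖z‖ ≤ r := by
    have := hAr (J x) (by simpa [hJn] using hx)
    rwa [hA] at this
  have hcoord : ∀ i : Fin (n + 1),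
      inner ℝ (T (e i)) (φ fun v => L v (J x)) / lam i - x i = inner ℝ (T (e i)) z / lam i := by
    intro i
    rw [inner_sub_right, he.inner_apply, show inner ℝ (e i) (J x) = x i from
      heF.inner_right_fintype x i, sub_div, mul_div_cancel_left₀ _ (hpos i).ne']
  -- Since `lam n ≤ lam i`, the scaled coordinate errors are dominated by the coefficients of `z` in
  -- the orthonormal system of normalized `T (e i)`; Bessel's inequality finishes.
  calc (∑ i, ‖(WithLp.toLp 2 (fun i : Fin (n + 1) => inner ℝ (T (e i))
          (φ fun v => L v (J x)) / lam i) - x) i‖ ^ 2) * lam n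
      ≤ ∑ i : Fin (n + 1), ‖inner ℝ ((√(lam i))⁻¹ • T (e i)) z‖ ^ 2 := by
        rw [Finset.sum_mul]
        refine Finset.sum_le_sum fun i _ => ?_
        rw [PiLp.sub_apply, PiLp.toLp_apply, hcoord, real_inner_smul_left, norm_mul, mul_pow,
          norm_inv, Real.norm_of_nonneg (Real.sqrt_nonneg _), inv_pow, Real.sq_sqrt (hpos i).le,
          norm_div, div_pow, Real.norm_of_nonneg (hpos i).le, div_mul_eq_mul_div,
          div_le_iff₀ (pow_pos (hpos i) 2), sq (lam i)]
        have := hpos i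
        rw [show (lam i)⁻¹ * ‖inner ℝ (T (e i)) z‖ ^ 2 * (lam i * lam i) =
          ‖inner ℝ (T (e i)) z‖ ^ 2 * lam i by field_simp]
        exact mul_le_mul_of_nonneg_left (hle i) (sq_nonneg _)
    _ ≤ ‖z‖ ^ 2 := hη.sum_inner_products_le z
    _ ≤ r ^ 2 := pow_le_pow_left₀ (norm_nonneg _) hz 2

end IsEigenpairSequence

/-! ### Permutations of the coordinates in `I` acting on multi-indices. -/

section Combinatorics

variable {d : ℕ} {I : Finset (Fin d)}

theorem mem_permsOn {π : Equiv.Perm (Fin d)} : π ∈ permsOn I ↔ ∀ i, i ∉ I → π i = i := by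
  simp [permsOn]

theorem inv_mem_permsOn {π : Equiv.Perm (Fin d)} (hπ : π ∈ permsOn I) : π⁻¹ ∈ permsOn I :=
  mem_permsOn.2 fun i hi => by rw [Equiv.Perm.inv_eq_iff_eq, mem_permsOn.1 hπ i hi]

theorem mul_mem_permsOn {π σ : Equiv.Perm (Fin d)} (hπ : π ∈ permsOn I) (hσ : σ ∈ permsOn I) :
    π * σ ∈ permsOn I :=
  mem_permsOn.2 fun i hi => by
    rw [Equiv.Perm.mul_apply, mem_permsOn.1 hσ i hi, mem_permsOn.1 hπ i hi]

theorem swap_mem_permsOn {a b : Fin d} (ha : a ∈ I) (hb : b ∈ I) :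
    Equiv.swap a b ∈ permsOn I :=
  mem_permsOn.2 fun _ hi => Equiv.swap_apply_of_ne_of_ne (fun h => hi (h ▸ ha))
    (fun h => hi (h ▸ hb))

theorem card_permsOn_pos : 0 < (permsOn I).card :=
  Finset.card_pos.2 ⟨1, mem_permsOn.2 fun _ _ => rfl⟩

theorem apply_mem_iff_of_mem_permsOn {π : Equiv.Perm (Fin d)} (hπ : π ∈ permsOn I) (i : Fin d) :
    π i ∈ I ↔ i ∈ I := by
  constructor
  · intro h
    by_contra hi
    rw [mem_permsOn.1 hπ i hi] at h
    exact hi h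
  · intro h
    by_contra hi
    have := π.injective (mem_permsOn.1 hπ (π i) hi)
    rw [this] at hi
    exact hi h

theorem card_stabilizer_eq_multFactorial (k : Fin d → ℕ) :
    ((permsOn I).filter fun π : Equiv.Perm (Fin d) => k ∘ π = k).card = multFactorial I k := by
  classical
  -- Giving each coordinate outside `I` a colour of its own turns the stabilizer of `k` in `permsOn
  -- I` into the full stabilizer of a colouring. The extra colour classes are singletons and
  -- contribute `1!`.
  let f : Fin d → ℕ ⊕ Fin d := fun l => if l ∈ I then Sum.inl (k l) else Sum.inr l
  have hfI : ∀ l ∈ I, f l = Sum.inl (k l) := fun l hl => if_pos hl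
  have hfI' : ∀ l ∉ I, f l = Sum.inr l := fun l hl => if_neg hl
  have hset : ((permsOn I).filter fun π : Equiv.Perm (Fin d) => k ∘ π = k) =
      Finset.univ.filter fun π : Equiv.Perm (Fin d) => f ∘ π = f := by
    ext π
    simp only [Finset.mem_filter, Finset.mem_univ, true_and]
    constructor
    · rintro ⟨hπ, hk⟩
      funext l
      by_cases hl : l ∈ I
      · rw [Function.comp_apply, hfI _ ((apply_mem_iff_of_mem_permsOn hπ l).2 hl), hfI l hl]
        exact congrArg Sum.inl (congrFun hk l)
      · rw [Function.comp_apply, mem_permsOn.1 hπ l hl]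
    · intro h
      have hπ : π ∈ permsOn I := mem_permsOn.2 fun l hl => by
        have h1 := congrFun h l
        rw [Function.comp_apply, hfI' l hl] at h1
        by_cases hl' : π l ∈ I
        · rw [hfI _ hl'] at h1
          cases h1
        · rw [hfI' _ hl'] at h1
          exact Sum.inr_injective h1
      refine ⟨hπ, funext fun l => ?_⟩
      by_cases hl : l ∈ I
      · have h1 := congrFun h l
        rw [Function.comp_apply, hfI _ ((apply_mem_iff_of_mem_permsOn hπ l).2 hl), hfI l hl] at h1
        exact Sum.inl_injective h1
      · rw [Function.comp_apply, mem_permsOn.1 hπ l hl]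
  rw [hset, ← Fintype.card_subtype, DomMulAct.stabilizer_card', multFactorial]
  have himg : Finset.univ.image f =
      (I.image k).image Sum.inl ∪ (Iᶜ).image Sum.inr := by
    ext y
    simp only [Finset.mem_image, Finset.mem_univ, true_and, Finset.mem_union, Finset.mem_compl]
    constructor
    · rintro ⟨l, rfl⟩
      by_cases hl : l ∈ I
      · exact Or.inl ⟨k l, ⟨l, hl, rfl⟩, (hfI l hl).symm⟩
      · exact Or.inr ⟨l, hl, (hfI' l hl).symm⟩
    · rintro (⟨_, ⟨l, hl, rfl⟩, rfl⟩ | ⟨l, hl, rfl⟩)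
      · exact ⟨l, hfI l hl⟩
      · exact ⟨l, hfI' l hl⟩
  have hdisj : Disjoint ((I.image k).image (Sum.inl : ℕ → ℕ ⊕ Fin d))
      ((Iᶜ).image (Sum.inr : Fin d → ℕ ⊕ Fin d)) := by
    rw [Finset.disjoint_left]
    simp
  rw [himg, Finset.prod_union hdisj, Finset.prod_image fun _ _ _ _ h => Sum.inl_injective h,
    Finset.prod_image fun _ _ _ _ h => Sum.inr_injective h]
  have h1 : ∀ l ∈ Iᶜ, (Fintype.card {a // f a = Sum.inr l}).factorial = 1 := by
    intro l _
    rw [Nat.factorial_eq_one, Fintype.card_le_one_iff_subsingleton]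
    refine ⟨fun a b => Subtype.ext ?_⟩
    have h2 : ∀ a, f a = Sum.inr l → a = l := by
      intro a ha
      by_cases haI : a ∈ I
      · rw [hfI a haI] at ha
        cases ha
      · rw [hfI' a haI] at ha
        exact Sum.inr_injective ha
    rw [h2 a a.2, h2 b b.2]
  rw [Finset.prod_eq_one h1, mul_one]
  refine Finset.prod_congr rfl fun j _ => ?_
  rw [Fintype.card_subtype]
  congr 2
  ext a
  simp only [Finset.mem_filter, Finset.mem_univ, true_and]
  by_cases haI : a ∈ I
  · simp [hfI a haI, haI]
  · simp [hfI' a haI, haI]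

theorem multFactorial_pos (k : Fin d → ℕ) : 0 < multFactorial I k :=
  Finset.prod_pos fun _ _ => Nat.factorial_pos _

theorem monotone_comp_orderEmbOfFin {k : Fin d → ℕ} :
    Monotone (k ∘ I.orderEmbOfFin rfl) ↔ MonotoneOn k (I : Set (Fin d)) := by
  constructor
  · intro h a ha b hb hab
    obtain ⟨i, rfl⟩ : a ∈ Set.range (I.orderEmbOfFin rfl) := by rwa [Finset.range_orderEmbOfFin]
    obtain ⟨j, rfl⟩ : b ∈ Set.range (I.orderEmbOfFin rfl) := by rwa [Finset.range_orderEmbOfFin]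
    exact h ((I.orderEmbOfFin rfl).le_iff_le.1 hab)
  · intro h i j hij
    exact h (I.orderEmbOfFin_mem rfl i) (I.orderEmbOfFin_mem rfl j)
      ((I.orderEmbOfFin rfl).monotone hij)

/-- Sort `k` along the increasing enumeration of `I`, and extend the sorting permutation by the
identity. -/
theorem exists_mem_permsOn_monotoneOn (I : Finset (Fin d)) (k : Fin d → ℕ) :
    ∃ π ∈ permsOn I, MonotoneOn (k ∘ π) (I : Set (Fin d)) := by
  let o := I.orderIsoOfFin rfl
  let σ := Tuple.sort (k ∘ I.orderEmbOfFin rfl)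
  let τ : Equiv.Perm I := (o.symm.toEquiv.trans σ).trans o.toEquiv
  refine ⟨Equiv.Perm.ofSubtype τ, mem_permsOn.2 fun i hi =>
    Equiv.Perm.ofSubtype_apply_of_not_mem τ hi, ?_⟩
  rw [← monotone_comp_orderEmbOfFin]
  have h : (k ∘ Equiv.Perm.ofSubtype τ) ∘ I.orderEmbOfFin rfl =
      (k ∘ I.orderEmbOfFin rfl) ∘ σ := by
    funext j
    have h1 : I.orderEmbOfFin rfl j = (o j : Fin d) := rfl
    have h2 : I.orderEmbOfFin rfl (σ j) = (o (σ j) : Fin d) := rfl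
    simp only [Function.comp_apply]
    rw [h1, h2, Equiv.Perm.ofSubtype_apply_coe]
    simp [τ]
  rw [h]
  exact Tuple.monotone_sort _

/-- A sorted rearrangement of a tuple is unique. This separates the orbits of different elements of
`nabla`. -/
theorem comp_eq_of_monotoneOn {π : Equiv.Perm (Fin d)} (hπ : π ∈ permsOn I) {k : Fin d → ℕ}
    (hk : MonotoneOn k (I : Set (Fin d))) (hkπ : MonotoneOn (k ∘ π) (I : Set (Fin d))) :
    k ∘ π = k := by
  let o := I.orderIsoOfFin rfl
  let τ : Equiv.Perm I := π.subtypePerm fun i => apply_mem_iff_of_mem_permsOn hπ i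
  let σ : Equiv.Perm (Fin I.card) := (o.toEquiv.trans τ).trans o.symm.toEquiv
  have h : (k ∘ π) ∘ I.orderEmbOfFin rfl = (k ∘ I.orderEmbOfFin rfl) ∘ σ := by
    funext j
    have h1 : I.orderEmbOfFin rfl j = (o j : Fin d) := rfl
    have h2 : I.orderEmbOfFin rfl (σ j) = (o (σ j) : Fin d) := rfl
    simp only [Function.comp_apply]
    rw [h1, h2]
    simp [σ, τ]
  rw [← monotone_comp_orderEmbOfFin] at hk hkπ
  rw [h] at hkπ
  have h3 := Tuple.unique_monotone (σ := σ) (τ := 1) hkπ hk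
  funext l
  by_cases hl : l ∈ I
  · obtain ⟨j, rfl⟩ : l ∈ Set.range (I.orderEmbOfFin rfl) := by rwa [Finset.range_orderEmbOfFin]
    exact (congrFun h j).trans (congrFun h3 j)
  · rw [Function.comp_apply, mem_permsOn.1 hπ l hl]

theorem monotoneOn_of_mem_nabla {s : SymmetryType} {k : Fin d → ℕ} (hk : k ∈ nabla s I) :
    MonotoneOn k (I : Set (Fin d)) := by
  cases s
  · exact hk
  · exact StrictMonoOn.monotoneOn hk

/-- In the antisymmetric case `k` is injective on `I`, so its stabilizer is trivial; hence no signs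
cancel in the norm of `xi`. -/
theorem factor_eq_one_of_mem_nabla {s : SymmetryType} {k : Fin d → ℕ} (hk : k ∈ nabla s I)
    {π : Equiv.Perm (Fin d)} (hπ : π ∈ permsOn I) (hkπ : k ∘ π = k) : s.factor π = 1 := by
  cases s
  · rfl
  · have h1 : π = 1 := by
      ext1 l
      by_cases hl : l ∈ I
      · exact (StrictMonoOn.injOn hk) ((apply_mem_iff_of_mem_permsOn hπ l).2 hl) hl (congrFun hkπ l)
      · exact mem_permsOn.1 hπ l hl
    simp [h1, SymmetryType.factor]

end Combinatorics

/-! ### Spectral decomposition of the restricted tensor product operator. -/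

section Tensor

variable {d : ℕ} {H G : Type*} [NormedAddCommGroup H] [InnerProductSpace ℝ H]
  [NormedAddCommGroup G] [InnerProductSpace ℝ G]

theorem inner_apply_eq_of_pureTensor
    {A : HilbertTensorPower d H →L[ℝ] HilbertTensorPower d G}
    {B : HilbertTensorPower d G →L[ℝ] HilbertTensorPower d H}
    (h : ∀ f g, inner ℝ (A (pureTensor f)) (pureTensor g) =
      inner ℝ (pureTensor f) (B (pureTensor g)))
    (x : HilbertTensorPower d H) (y : HilbertTensorPower d G) :
    inner ℝ (A x) y = inner ℝ x (B y) := by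
  have h1 : ∀ f : Fin d → H, innerSL ℝ (A (pureTensor f)) = (innerSL ℝ (pureTensor f)).comp B :=
    fun f => tensor_hom_ext fun g => h f g
  have h2 : (innerSL ℝ y).comp A = innerSL ℝ (B y) := tensor_hom_ext fun f => by
    have := congrArg (fun L => L y) (h1 f)
    simp only [innerSL_apply_apply, ContinuousLinearMap.comp_apply] at this ⊢
    rw [real_inner_comm, this, real_inner_comm]
  have h3 := congrArg (fun L => L x) h2
  simp only [innerSL_apply_apply, ContinuousLinearMap.comp_apply] at h3
  rw [real_inner_comm, h3, real_inner_comm]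

theorem adjoint_tensorOp [CompleteSpace H] [CompleteSpace G] (S : H →L[ℝ] G) :
    (tensorOp d S).adjoint = tensorOp d S.adjoint := by
  refine ((ContinuousLinearMap.eq_adjoint_iff _ _).2
    (inner_apply_eq_of_pureTensor fun f g => ?_)).symm
  simp only [tensorOp_pureTensor, inner_pureTensor, ContinuousLinearMap.adjoint_inner_left]

theorem inner_permOp_left (π : Equiv.Perm (Fin d)) (x y : HilbertTensorPower d H) :
    inner ℝ (permOp H π x) y = inner ℝ x (permOp H π⁻¹ y) := by
  refine inner_apply_eq_of_pureTensor (fun f g => ?_) x y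
  simp only [permOp_pureTensor, inner_pureTensor]
  rw [← Equiv.prod_comp π fun l => inner ℝ (f l) (g (π⁻¹ l))]
  simp

theorem tensorOp_permOp (S : H →L[ℝ] G) (π : Equiv.Perm (Fin d)) (x : HilbertTensorPower d H) :
    tensorOp d S (permOp H π x) = permOp G π (tensorOp d S x) := by
  have h : (tensorOp d S).comp (permOp H π) = (permOp G π).comp (tensorOp d S) :=
    tensor_hom_ext fun f => by
      simp only [ContinuousLinearMap.comp_apply, permOp_pureTensor, tensorOp_pureTensor]
  exact congrArg (fun L => L x) h

theorem SymmetryType.factor_inv (s : SymmetryType) (π : Equiv.Perm (Fin d)) :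
    s.factor π⁻¹ = s.factor π := by
  cases s <;> simp [SymmetryType.factor]

theorem SymmetryType.factor_mul_self (s : SymmetryType) (π : Equiv.Perm (Fin d)) :
    s.factor π * s.factor π = 1 := by
  nth_rewrite 1 [← s.factor_inv π]
  rw [← SymmetryType.factor_mul, inv_mul_cancel]
  cases s <;> simp [SymmetryType.factor]

variable (s : SymmetryType) (I : Finset (Fin d))

theorem symmetrizer_apply (x : HilbertTensorPower d H) :
    symmetrizer s I H x =
      ((permsOn I).card : ℝ)⁻¹ • ∑ π ∈ permsOn I, s.factor π • permOp H π x := by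
  simp [symmetrizer]

theorem inner_symmetrizer_left (x y : HilbertTensorPower d H) :
    inner ℝ (symmetrizer s I H x) y = inner ℝ x (symmetrizer s I H y) := by
  rw [symmetrizer_apply, symmetrizer_apply, real_inner_smul_left, real_inner_smul_right, sum_inner,
    inner_sum]
  congr 1
  refine Finset.sum_bij' (fun π _ => π⁻¹) (fun π _ => π⁻¹) (fun π hπ => inv_mem_permsOn hπ)
    (fun π hπ => inv_mem_permsOn hπ) (fun π _ => inv_inv π) (fun π _ => inv_inv π) fun π _ => ?_
  rw [real_inner_smul_left, real_inner_smul_right, inner_permOp_left, SymmetryType.factor_inv]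

theorem tensorOp_symmetrizer (S : H →L[ℝ] G) (x : HilbertTensorPower d H) :
    tensorOp d S (symmetrizer s I H x) = symmetrizer s I G (tensorOp d S x) := by
  simp only [symmetrizer_apply, map_smul, map_sum, tensorOp_permOp]

theorem permOp_symmetrizer {π : Equiv.Perm (Fin d)} (hπ : π ∈ permsOn I)
    (x : HilbertTensorPower d H) :
    permOp H π (symmetrizer s I H x) = s.factor π • symmetrizer s I H x := by
  rw [symmetrizer_apply, map_smul, map_sum, smul_comm (s.factor π),
    Finset.smul_sum (r := s.factor π)]
  congr 1
  refine Finset.sum_bij' (fun σ _ => σ * π) (fun σ _ => σ * π⁻¹)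
    (fun σ hσ => mul_mem_permsOn hσ hπ) (fun σ hσ => mul_mem_permsOn hσ (inv_mem_permsOn hπ))
    (fun σ _ => by simp) (fun σ _ => by simp) fun σ _ => ?_
  rw [map_smul, ← ContinuousLinearMap.comp_apply, permOp_comp, SymmetryType.factor_mul, smul_smul,
    mul_comm (s.factor σ), ← mul_assoc, SymmetryType.factor_mul_self, one_mul]

variable {s I}

theorem symmetrizer_eq_self_of_mem {x : HilbertTensorPower d H} (hx : x ∈ symSubspace s I H) :
    symmetrizer s I H x = x := by
  obtain ⟨y, rfl⟩ := hx
  exact congrArg (fun A => A y) (symmetrizer_comp_self s I H)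

theorem permOp_of_mem_symSubspace {π : Equiv.Perm (Fin d)} (hπ : π ∈ permsOn I)
    {x : HilbertTensorPower d H} (hx : x ∈ symSubspace s I H) :
    permOp H π x = s.factor π • x := by
  rw [← symmetrizer_eq_self_of_mem hx, permOp_symmetrizer s I hπ]

theorem tensorOp_mem_symSubspace (S : H →L[ℝ] G) {x : HilbertTensorPower d H}
    (hx : x ∈ symSubspace s I H) : tensorOp d S x ∈ symSubspace s I G := by
  rw [← symmetrizer_eq_self_of_mem hx, tensorOp_symmetrizer]
  exact LinearMap.mem_range_self _ _

/-- The adjoint is again a tensor power, so `W_d f` stays in the subspace; there it is determined by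
pairing with elements of the subspace. -/
theorem adjoint_tensorOp_eq_adjoint_symProblem [CompleteSpace H] [CompleteSpace G]
    (S : H →L[ℝ] G) (f : symSubspace s I H) :
    (tensorOp d S).adjoint (tensorOp d S f) =
      (((symProblem s I S).adjoint (symProblem s I S f) : symSubspace s I H) :
        HilbertTensorPower d H) := by
  have hmem : (tensorOp d S).adjoint (tensorOp d S f) ∈ symSubspace s I H := by
    rw [adjoint_tensorOp]
    exact tensorOp_mem_symSubspace _ (tensorOp_mem_symSubspace _ f.2)
  have h : (⟨_, hmem⟩ : symSubspace s I H) = (symProblem s I S).adjoint (symProblem s I S f) := by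
    refine ext_inner_right ℝ fun g => ?_
    rw [ContinuousLinearMap.adjoint_inner_left, Submodule.coe_inner,
      ContinuousLinearMap.adjoint_inner_left]
    rfl
  exact congrArg Subtype.val h

/-! ### The eigenvectors -/

theorem coe_xi (e : ℕ → H) (k : Fin d → ℕ) :
    (xi s I e k : HilbertTensorPower d H) =
      √(((permsOn I).card : ℝ) / (multFactorial I k : ℝ)) •
        symmetrizer s I H (pureTensor fun l => e (k l)) := rfl

theorem card_div_multFactorial_pos (k : Fin d → ℕ) :
    0 < ((permsOn I).card : ℝ) / (multFactorial I k : ℝ) :=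
  div_pos (Nat.cast_pos.2 card_permsOn_pos) (Nat.cast_pos.2 (multFactorial_pos k))

/-- As the symmetrizer is a self-adjoint idempotent, only one of the two sums over permutations
survives, and tensors of the `e i` with different indices are orthogonal. -/
theorem inner_symmetrizer_pureTensor {e : ℕ → H} (he : Orthonormal ℝ e) (j k : Fin d → ℕ) :
    inner ℝ (symmetrizer s I H (pureTensor fun l => e (j l)))
        (symmetrizer s I H (pureTensor fun l => e (k l))) =
      ((permsOn I).card : ℝ)⁻¹ *
        ∑ π ∈ permsOn I, if j ∘ π = k then s.factor π else 0 := by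
  rw [← inner_symmetrizer_left,
    symmetrizer_eq_self_of_mem (x := symmetrizer s I H _) (LinearMap.mem_range_self _ _),
    symmetrizer_apply, real_inner_smul_left, sum_inner]
  congr 1
  refine Finset.sum_congr rfl fun π _ => ?_
  rw [permOp_pureTensor, real_inner_smul_left, inner_pureTensor]
  split_ifs with h
  · rw [Finset.prod_eq_one, mul_one]
    intro l _
    rw [← h, Function.comp_apply, real_inner_self_eq_norm_sq, he.1, one_pow]
  · obtain ⟨l, hl⟩ := Function.ne_iff.1 h
    rw [Finset.prod_eq_zero (Finset.mem_univ l) (he.2 hl), mul_zero]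

theorem orthonormal_xi {e : ℕ → H} (he : Orthonormal ℝ e) :
    Orthonormal ℝ fun k : nabla s I => xi s I e (k : Fin d → ℕ) := by
  classical
  rw [orthonormal_iff_ite]
  rintro ⟨j, hj⟩ ⟨k, hk⟩
  rw [Submodule.coe_inner, coe_xi, coe_xi, real_inner_smul_left, real_inner_smul_right,
    inner_symmetrizer_pureTensor he]
  by_cases hjk : j = k
  · subst hjk
    rw [if_pos rfl]
    have hsum : (∑ π ∈ permsOn I, if j ∘ π = j then s.factor π else 0) = multFactorial I j := by
      rw [← card_stabilizer_eq_multFactorial, ← Finset.sum_filter, Finset.card_eq_sum_ones,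
        Nat.cast_sum]
      refine Finset.sum_congr rfl fun π hπ => ?_
      rw [Finset.mem_filter] at hπ
      rw [factor_eq_one_of_mem_nabla hj hπ.1 hπ.2, Nat.cast_one]
    rw [hsum, ← mul_assoc, Real.mul_self_sqrt (card_div_multFactorial_pos j).le]
    have h1 : ((permsOn I).card : ℝ) ≠ 0 := Nat.cast_ne_zero.2 card_permsOn_pos.ne'
    have h2 : (multFactorial I j : ℝ) ≠ 0 := Nat.cast_ne_zero.2 (multFactorial_pos j).ne'
    field_simp
  · rw [if_neg (by simpa using hjk), Finset.sum_eq_zero, mul_zero, mul_zero, mul_zero]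
    intro π hπ
    rw [if_neg]
    intro h
    change j ∘ π = k at h
    refine hjk ?_
    rw [← h]
    refine (comp_eq_of_monotoneOn hπ (monotoneOn_of_mem_nabla hj) ?_).symm
    rw [h]
    exact monotoneOn_of_mem_nabla hk

/-- Permuting indices within `I` changes the pairing with `f` only by the factor of the permutation,
so it suffices to treat sorted indices. -/
theorem inner_pureTensor_eq_zero_of_inner_xi {e : ℕ → H} {f : symSubspace s I H}
    (hf : ∀ k ∈ nabla s I, inner ℝ (xi s I e k) f = 0) (k : Fin d → ℕ) :
    inner ℝ (f : HilbertTensorPower d H) (pureTensor fun l => e (k l)) = 0 := by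
  have hnabla : ∀ j ∈ nabla s I,
      inner ℝ (f : HilbertTensorPower d H) (pureTensor fun l => e (j l)) = 0 := by
    intro j hj
    have h1 := hf j hj
    rw [Submodule.coe_inner, coe_xi, real_inner_smul_left, inner_symmetrizer_left,
      symmetrizer_eq_self_of_mem f.2] at h1
    rw [real_inner_comm]
    exact (mul_eq_zero.1 h1).resolve_left
      (Real.sqrt_pos.2 (card_div_multFactorial_pos j)).ne'
  have hperm : ∀ π ∈ permsOn I, ∀ j : Fin d → ℕ,
      inner ℝ (f : HilbertTensorPower d H) (pureTensor fun l => e ((j ∘ π) l)) =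
        s.factor π * inner ℝ (f : HilbertTensorPower d H) (pureTensor fun l => e (j l)) := by
    intro π hπ j
    have h1 : pureTensor (fun l => e ((j ∘ π) l)) = permOp H π (pureTensor fun l => e (j l)) := by
      rw [permOp_pureTensor]
      rfl
    rw [h1, real_inner_comm, inner_permOp_left, permOp_of_mem_symSubspace (inv_mem_permsOn hπ) f.2,
      real_inner_smul_right, real_inner_comm, SymmetryType.factor_inv]
  obtain ⟨π, hπ, hmono⟩ := exists_mem_permsOn_monotoneOn I k
  have hzero : inner ℝ (f : HilbertTensorPower d H) (pureTensor fun l => e ((k ∘ π) l)) = 0 := by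
    by_cases hmem : k ∘ π ∈ nabla s I
    · exact hnabla _ hmem
    · cases s with
      | symmetric => exact absurd hmono hmem
      -- A sorted index outside `nabla` has two equal entries in `I`. Swapping them fixes the tensor
      -- but negates the pairing.
      | antisymmetric =>
        have hninj : ¬ Set.InjOn (k ∘ π) (I : Set (Fin d)) := fun hinj =>
          hmem (hmono.strictMonoOn_of_injOn hinj)
        simp only [Set.InjOn, not_forall] at hninj
        obtain ⟨a, ha, b, hb, hab, hne⟩ := hninj
        have h1 := hperm _ (swap_mem_permsOn ha hb) (k ∘ π)
        have h2 : (k ∘ π) ∘ Equiv.swap a b = k ∘ π := by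
          funext l
          rw [Function.comp_apply]
          rcases eq_or_ne l a with rfl | hla
          · rw [Equiv.swap_apply_left, hab]
          · rcases eq_or_ne l b with rfl | hlb
            · rw [Equiv.swap_apply_right, hab]
            · rw [Equiv.swap_apply_of_ne_of_ne hla hlb]
        have h3 : SymmetryType.antisymmetric.factor (Equiv.swap a b) = -1 := by
          simp [SymmetryType.factor, Equiv.Perm.sign_swap hne]
        rw [h2, h3] at h1
        linarith
  rw [hperm π hπ] at hzero
  refine (mul_eq_zero.1 hzero).resolve_left fun h => ?_
  have := s.factor_mul_self π
  rw [h, zero_mul] at this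
  exact zero_ne_one this

theorem norm_pureTensor (f : Fin d → H) : ‖pureTensor f‖ = ∏ l, ‖f l‖ := by
  rw [← sq_eq_sq₀ (norm_nonneg _) (Finset.prod_nonneg fun _ _ => norm_nonneg _),
    ← real_inner_self_eq_norm_sq, inner_pureTensor, ← Finset.prod_pow]
  simp

/-- A simple tensor as a continuous linear function of one of its factors. -/
noncomputable def pureTensorUpdate (f : Fin d → H) (a : Fin d) : H →L[ℝ] HilbertTensorPower d H :=
  LinearMap.mkContinuous
    ((UniformSpace.Completion.toComplL (𝕜 := ℝ) (E := AlgTensorPower d H)).toLinearMap.comp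
      ((AlgTensorPower.tprod d H).toLinearMap f a))
    (∏ l ∈ Finset.univ.erase a, ‖f l‖) fun x => by
      change ‖pureTensor (Function.update f a x)‖ ≤ _
      rw [norm_pureTensor, ← Finset.mul_prod_erase _ _ (Finset.mem_univ a), Function.update_self,
        mul_comm]
      refine le_of_eq (congrArg (· * ‖x‖) (Finset.prod_congr rfl fun l hl => ?_))
      rw [Function.update_of_ne (Finset.ne_of_mem_erase hl)]

theorem inner_pureTensor_eq_zero_of_mem_closure {e : ℕ → H} {f : HilbertTensorPower d H}
    (hf : ∀ k : Fin d → ℕ, inner ℝ f (pureTensor fun l => e (k l)) = 0) {g : Fin d → H}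
    (hg : ∀ l, g l ∈ (Submodule.span ℝ (Set.range e)).topologicalClosure) :
    inner ℝ f (pureTensor g) = 0 := by
  -- Factors are released one at a time: `t` holds the coordinates already allowed in the closed
  -- span, the others still being some `e i`. In each factor the pairing is continuous and linear,
  -- so its kernel is closed.
  have key : ∀ (t : Finset (Fin d)) (g : Fin d → H),
      (∀ l ∈ t, g l ∈ (Submodule.span ℝ (Set.range e)).topologicalClosure) →
      (∀ l ∉ t, g l ∈ Set.range e) → inner ℝ f (pureTensor g) = 0 := by
    intro t
    induction t using Finset.induction_on with
    | empty =>
      intro g _ hg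
      choose k hk using fun l => hg l (Finset.notMem_empty l)
      rw [← funext hk]
      exact hf k
    | insert a t ha ih =>
      intro g hg hg'
      let L : H →L[ℝ] ℝ := (innerSL ℝ f).comp (pureTensorUpdate g a)
      have hL : (Submodule.span ℝ (Set.range e)).topologicalClosure ≤ L.ker := by
        refine Submodule.topologicalClosure_minimal _ (Submodule.span_le.2 ?_) L.isClosed_ker
        rintro x hx
        change inner ℝ f (pureTensor (Function.update g a x)) = 0
        refine ih _ (fun l hl => ?_) fun l hl => ?_
        · rw [Function.update_of_ne (ne_of_mem_of_not_mem hl ha)]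
          exact hg l (Finset.mem_insert_of_mem hl)
        · rcases eq_or_ne l a with rfl | hla
          · rwa [Function.update_self]
          · rw [Function.update_of_ne hla]
            exact hg' l fun h => (Finset.mem_insert.1 h).elim hla hl
      have h1 : inner ℝ f (pureTensor (Function.update g a (g a))) = 0 :=
        hL (hg a (Finset.mem_insert_self a t))
      rwa [Function.update_eq_self] at h1
  exact key Finset.univ g (fun l _ => hg l) fun l hl => absurd (Finset.mem_univ l) hl

theorem eq_zero_of_inner_pureTensor {f : HilbertTensorPower d H}
    (hf : ∀ g, inner ℝ f (pureTensor g) = 0) : f = 0 := by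
  have h : innerSL ℝ f = 0 := tensor_hom_ext fun g => by simpa using hf g
  have h1 := congrArg (fun L => L f) h
  simpa using h1

theorem topologicalClosure_span_xi [CompleteSpace H] {e : ℕ → H}
    (he : (Submodule.span ℝ (Set.range e)).topologicalClosure = ⊤) :
    (Submodule.span ℝ (Set.range fun k : nabla s I =>
      xi s I e (k : Fin d → ℕ))).topologicalClosure = ⊤ := by
  rw [Submodule.topologicalClosure_eq_top_iff, Submodule.eq_bot_iff]
  intro f hf
  have h1 : ∀ k ∈ nabla s I, inner ℝ (xi s I e k) f = 0 := fun k hk =>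
    hf _ (Submodule.subset_span ⟨⟨k, hk⟩, rfl⟩)
  refine Subtype.ext (eq_zero_of_inner_pureTensor fun g => ?_)
  exact inner_pureTensor_eq_zero_of_mem_closure (inner_pureTensor_eq_zero_of_inner_xi h1)
    fun l => he ▸ Submodule.mem_top

variable [CompleteSpace H] [CompleteSpace G]

/-- Vectors orthogonal to all `e i` lie in the kernel of `T`, to which the range of `T†` is
orthogonal. -/
theorem IsEigenpairSequence.apply_mem_closure {T : H →L[ℝ] G} {e : ℕ → H} {lam : ℕ → ℝ}
    (he : IsEigenpairSequence (T.adjoint.comp T) e lam) (x : H) :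
    T.adjoint (T x) ∈ (Submodule.span ℝ (Set.range e)).topologicalClosure := by
  rw [← Submodule.orthogonal_orthogonal_eq_closure]
  intro y hy
  have h1 : T y = 0 := he.apply_eq_zero fun i => hy _ (Submodule.subset_span ⟨i, rfl⟩)
  rw [ContinuousLinearMap.adjoint_inner_right, h1, inner_zero_left]

theorem isEigenpairSequence_xi {S : H →L[ℝ] G} {e : ℕ → H} {lam : ℕ → ℝ}
    (he : IsEigenpairSequence (S.adjoint.comp S) e lam) (ψ : ℕ ≃ nabla s I)
    (hψ : Antitone fun v => lamProd lam (ψ v : Fin d → ℕ)) :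
    IsEigenpairSequence ((symProblem s I S).adjoint.comp (symProblem s I S))
      (fun v => xi s I e (ψ v)) (fun v => lamProd lam (ψ v : Fin d → ℕ)) where
  orthonormal := (orthonormal_xi he.orthonormal).comp ψ ψ.injective
  eigen v := by
    refine Subtype.ext ?_
    rw [ContinuousLinearMap.comp_apply, ← adjoint_tensorOp_eq_adjoint_symProblem, adjoint_tensorOp,
      Submodule.coe_smul, coe_xi, map_smul, map_smul, tensorOp_symmetrizer, tensorOp_symmetrizer,
      tensorOp_pureTensor, tensorOp_pureTensor, smul_comm]
    congr 1
    rw [← map_smul]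
    congr 1
    have h1 : (fun l => S.adjoint (S (e ((ψ v : Fin d → ℕ) l)))) =
        fun l => lam ((ψ v : Fin d → ℕ) l) • e ((ψ v : Fin d → ℕ) l) :=
      funext fun l => he.eigen _
    rw [h1, pureTensor, MultilinearMap.map_smul_univ]
    exact UniformSpace.Completion.coe_smul _ _
  antitone := hψ
  nonneg v := Finset.prod_nonneg fun l _ => he.nonneg _
  exhausts f hf := by
    have h1 : ∀ k ∈ nabla s I, inner ℝ (xi s I e k) f = 0 := fun k hk => by
      have := hf (ψ.symm ⟨k, hk⟩)
      rwa [Equiv.apply_symm_apply] at this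
    refine Subtype.ext ?_
    rw [ContinuousLinearMap.comp_apply, ← adjoint_tensorOp_eq_adjoint_symProblem]
    refine eq_zero_of_inner_pureTensor fun g => ?_
    -- Moving `W_d` onto the test tensor puts every factor into the closed span of the `e i`.
    rw [ContinuousLinearMap.adjoint_inner_left, ← ContinuousLinearMap.adjoint_inner_right,
      adjoint_tensorOp, tensorOp_pureTensor, tensorOp_pureTensor]
    exact inner_pureTensor_eq_zero_of_mem_closure (inner_pureTensor_eq_zero_of_inner_xi h1)
      fun l => he.apply_mem_closure _

end Tensor

/-! ### Non-increasing enumeration of the product eigenvalues. -/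

section Ordering

theorem exists_equiv_nat_strictMono {X : Type*} [Infinite X] {rank : X → ℕ}
    (hrank : Function.Injective rank) : ∃ ψ : ℕ ≃ X, StrictMono fun v => rank (ψ v) := by
  have : Infinite (Set.range rank) := Set.infinite_coe_iff.2 (Set.infinite_range_of_injective hrank)
  let o := Nat.Subtype.orderIsoOfNat (Set.range rank)
  refine ⟨o.toEquiv.trans (Equiv.ofInjective rank hrank).symm, fun v w hvw => ?_⟩
  have h : ∀ v, rank ((o.toEquiv.trans (Equiv.ofInjective rank hrank).symm) v) = o v := fun v =>
    Equiv.apply_ofInjective_symm hrank (o v)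
  simp only [h]
  exact o.strictMono hvw

/-- A non-negative function on a countably infinite type, with finite superlevel sets, has a
non-increasing enumeration if it is positive everywhere or only finitely often. -/
theorem exists_equiv_nat_antitone {X : Type*} [Infinite X] [Countable X] {f : X → ℝ}
    (hf : ∀ x, 0 ≤ f x) (hfin : ∀ ε > 0, {x | ε ≤ f x}.Finite)
    (hpos : (∀ x, 0 < f x) ∨ {x | 0 < f x}.Finite) :
    ∃ ψ : ℕ ≃ X, Antitone fun v => f (ψ v) := by
  classical
  obtain ⟨enc, henc⟩ := exists_injective_nat X
  let before : X → Set X := fun x => {y | f x < f y ∨ f x = f y ∧ enc y < enc x}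
  have hbf : ∀ x, 0 < f x → (before x).Finite := fun x hx =>
    (hfin (f x) hx).subset fun y hy => hy.elim le_of_lt fun h => h.1.le
  have hblt : ∀ x y, 0 < f y → x ∈ before y → (before x).ncard < (before y).ncard := by
    intro x y hy hxy
    refine Set.ncard_lt_ncard ⟨fun z hz => ?_, fun h => ?_⟩ (hbf y hy)
    · rcases hxy with h1 | ⟨h1, h2⟩ <;> rcases hz with h3 | ⟨h3, h4⟩
      · exact Or.inl (h1.trans h3)
      · exact Or.inl (h3 ▸ h1)
      · exact Or.inl (h1 ▸ h3)
      · exact Or.inr ⟨h1.trans h3, h4.trans h2⟩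
    · rcases h hxy with h1 | ⟨-, h1⟩ <;> exact lt_irrefl _ h1
  let M : ℕ := {x | 0 < f x}.ncard
  -- A positive value is ranked by the finite number of its predecessors, with ties broken by `enc`.
  -- Zeros follow all `M` positive values; they occur only when `M` counts a finite set.
  let rank : X → ℕ := fun x => if 0 < f x then (before x).ncard else M + enc x
  have hlt : ∀ x y, f y < f x → rank x < rank y := by
    intro x y hxy
    have hx : 0 < f x := (hf y).trans_lt hxy
    by_cases hy : 0 < f y
    · simp only [rank, if_pos hx, if_pos hy]
      exact hblt x y hy (Or.inl hxy)
    · simp only [rank, if_pos hx, if_neg hy]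
      have hP : {x | 0 < f x}.Finite := hpos.resolve_left fun h => hy (h y)
      refine lt_of_lt_of_le (Set.ncard_lt_ncard ⟨fun z hz => ?_, fun h => ?_⟩ hP)
        (Nat.le_add_right _ _)
      · exact hz.elim hx.trans fun h => hx.trans_le h.1.le
      · rcases h hx with h1 | ⟨-, h1⟩ <;> exact lt_irrefl _ h1
  have hinj : Function.Injective rank := by
    intro x y hxy
    rcases lt_trichotomy (f x) (f y) with h | h | h
    · exact absurd hxy (hlt y x h).ne'
    · by_cases hx : 0 < f x
      · have hy : 0 < f y := h ▸ hx
        simp only [rank, if_pos hx, if_pos hy] at hxy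
        rcases lt_trichotomy (enc x) (enc y) with h1 | h1 | h1
        · exact absurd hxy (hblt x y hy (Or.inr ⟨h.symm, h1⟩)).ne
        · exact henc h1
        · exact absurd hxy (hblt y x hx (Or.inr ⟨h, h1⟩)).ne'
      · have hy : ¬ 0 < f y := h ▸ hx
        simp only [rank, if_neg hx, if_neg hy] at hxy
        exact henc (Nat.add_left_cancel hxy)
    · exact absurd hxy (hlt x y h).ne
  obtain ⟨ψ, hψ⟩ := exists_equiv_nat_strictMono hinj
  refine ⟨ψ, fun v w hvw => ?_⟩
  by_contra! h
  exact absurd (hψ.monotone hvw) (not_le.2 (hlt _ _ h))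

/-- The images `T (e i)` are orthogonal with squared norms `lam i`. Were these all at least `ε`, the
images would be uniformly separated and have no convergent subsequence. -/
theorem IsEigenpairSequence.tendsto_zero {F Y : Type*} [NormedAddCommGroup F]
    [InnerProductSpace ℝ F] [CompleteSpace F] [NormedAddCommGroup Y] [InnerProductSpace ℝ Y]
    [CompleteSpace Y] {T : F →L[ℝ] Y} (hT : IsCompactOperator T) {e : ℕ → F} {lam : ℕ → ℝ}
    (he : IsEigenpairSequence (T.adjoint.comp T) e lam) {ε : ℝ} (hε : 0 < ε) :
    ∃ m, lam m < ε := by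
  by_contra! hlam
  have hdist : ∀ i j, i ≠ j → 2 * ε ≤ dist (T (e i)) (T (e j)) ^ 2 := by
    intro i j hij
    rw [dist_eq_norm, norm_sub_sq_real, he.inner_apply, he.orthonormal.2 hij, he.norm_apply,
      he.norm_apply, Real.sq_sqrt (he.nonneg i), Real.sq_sqrt (he.nonneg j)]
    linarith [hlam i, hlam j]
  have hK : IsCompact (closure (T '' Metric.closedBall 0 1)) :=
    IsCompactOperator.isCompact_closure_image_closedBall (f := (T : F →ₗ[ℝ] Y)) hT 1
  obtain ⟨y, -, φ, hφ, hlim⟩ := hK.tendsto_subseq (x := fun i => T (e i)) fun i =>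
    subset_closure ⟨e i, by simp [he.orthonormal.1 i], rfl⟩
  obtain ⟨N, hN⟩ := Metric.cauchySeq_iff.1 hlim.cauchySeq (√ε) (Real.sqrt_pos.2 hε)
  have h1 := hN N le_rfl (N + 1) (Nat.le_succ N)
  have h2 := hdist (φ N) (φ (N + 1)) (hφ (Nat.lt_succ_self N)).ne
  have h3 : dist (T (e (φ N))) (T (e (φ (N + 1)))) ^ 2 < ε := by
    rw [← Real.sq_sqrt hε.le]
    exact pow_lt_pow_left₀ h1 dist_nonneg two_ne_zero
  linarith

theorem infinite_nabla {d : ℕ} (hd : 0 < d) (s : SymmetryType) (I : Finset (Fin d)) :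
    (nabla s I).Infinite := by
  refine Set.infinite_of_injective_forall_mem (f := fun (m : ℕ) (l : Fin d) => m + (l : ℕ))
    (fun m m' h => Nat.add_right_cancel (congrFun h ⟨0, hd⟩)) fun m => ?_
  have h : StrictMono fun l : Fin d => m + (l : ℕ) := fun l l' hl => Nat.add_lt_add_left hl m
  cases s
  · exact h.monotone.monotoneOn _
  · exact h.strictMonoOn _

/-- One factor `lam (k l)` with `k l ≥ m` already makes the product small, the other `d - 1` factors
being bounded by `lam 0 + 1`; the summand 1 keeps the divisor positive. -/
theorem finite_le_lamProd {d : ℕ} {lam : ℕ → ℝ} (hanti : Antitone lam) (hnonneg : ∀ i, 0 ≤ lam i)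
    (hlim : ∀ ε > 0, ∃ m, lam m < ε) {ε : ℝ} (hε : 0 < ε) :
    {k : Fin d → ℕ | ε ≤ lamProd lam k}.Finite := by
  obtain ⟨m, hm⟩ := hlim (ε / (lam 0 + 1) ^ (d - 1))
    (div_pos hε (pow_pos (by linarith [hnonneg 0]) _))
  refine (Set.Finite.pi' fun _ : Fin d => Set.finite_Iio m).subset fun k hk l => ?_
  by_contra hl
  have hml : m ≤ k l := not_lt.1 hl
  refine absurd (show ε ≤ lamProd lam k from hk) (not_le.2 ?_)
  rw [lamProd, ← Finset.mul_prod_erase _ _ (Finset.mem_univ l)]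
  have hpos : 0 < (lam 0 + 1) ^ (d - 1) := pow_pos (by linarith [hnonneg 0]) _
  have h1 : ∏ i ∈ Finset.univ.erase l, lam (k i) ≤ (lam 0 + 1) ^ (d - 1) := by
    refine (Finset.prod_le_prod (g := fun _ => lam 0 + 1) (fun i _ => hnonneg _) fun i _ =>
      (hanti (Nat.zero_le (k i))).trans (by linarith)).trans (le_of_eq ?_)
    rw [Finset.prod_const, Finset.card_erase_of_mem (Finset.mem_univ l), Finset.card_univ,
      Fintype.card_fin]
  calc lam (k l) * ∏ i ∈ Finset.univ.erase l, lam (k i)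
      ≤ lam (k l) * (lam 0 + 1) ^ (d - 1) := mul_le_mul_of_nonneg_left h1 (hnonneg _)
    _ ≤ lam m * (lam 0 + 1) ^ (d - 1) := mul_le_mul_of_nonneg_right (hanti hml) hpos.le
    _ < ε := (lt_div_iff₀ hpos).1 hm

theorem exists_antitone_lamProd {d : ℕ} (hd : 0 < d) (s : SymmetryType) (I : Finset (Fin d))
    {lam : ℕ → ℝ} (hanti : Antitone lam) (hnonneg : ∀ i, 0 ≤ lam i)
    (hlim : ∀ ε > 0, ∃ m, lam m < ε) :
    ∃ ψ : ℕ ≃ nabla s I, Antitone fun v => lamProd lam (ψ v : Fin d → ℕ) := by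
  have : Infinite (nabla s I) := (infinite_nabla hd s I).to_subtype
  refine exists_equiv_nat_antitone (f := fun k : nabla s I => lamProd lam (k : Fin d → ℕ))
    (fun k => Finset.prod_nonneg fun l _ => hnonneg _) (fun ε hε => ?_) ?_
  · exact Set.Finite.preimage (f := Subtype.val) Subtype.val_injective.injOn
      (finite_le_lamProd hanti hnonneg hlim hε)
  -- Either every product is positive, or `lam` vanishes from some `m` on and a positive product
  -- forces all entries of `k` below `m`.
  · by_cases hpos : ∀ m, 0 < lam m
    · exact Or.inl fun k => Finset.prod_pos fun l _ => hpos _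
    · right
      simp only [not_forall, not_lt] at hpos
      obtain ⟨m, hm⟩ := hpos
      have hfin : {k : Fin d → ℕ | 0 < lamProd lam k}.Finite := by
        refine (Set.Finite.pi' fun _ : Fin d => Set.finite_Iio m).subset fun k hk l => ?_
        by_contra hl
        have h0 : lam (k l) = 0 :=
          le_antisymm ((hanti (not_lt.1 hl)).trans hm) (hnonneg _)
        have h1 : lamProd lam k = 0 := Finset.prod_eq_zero (Finset.mem_univ l) h0
        exact (ne_of_gt hk) h1
      exact Set.Finite.preimage (f := Subtype.val) Subtype.val_injective.injOn hfin

end Ordering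

/-! ### The main theorem, assembled from the spectral and optimality results. -/

theorem theorem1 {H G : Type*}
    [NormedAddCommGroup H] [InnerProductSpace ℝ H] [CompleteSpace H]
    [TopologicalSpace.SeparableSpace H]
    [NormedAddCommGroup G] [InnerProductSpace ℝ G] [CompleteSpace G]
    (S : H →L[ℝ] G) (hS : IsCompactOperator S)
    (e : ℕ → H) (lam : ℕ → ℝ)
    (he : IsEigenpairSequence ((ContinuousLinearMap.adjoint S).comp S) e lam)
    (d : ℕ) (hd : 1 < d) (I : Finset (Fin d)) (hI : I.Nonempty) (s : SymmetryType) :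
    (∃ ψ : ℕ ≃ nabla s I, Antitone fun v => lamProd lam (ψ v : Fin d → ℕ)) ∧
    (∀ f : symSubspace s I H,
      (ContinuousLinearMap.adjoint (tensorOp d S)) (tensorOp d S f) =
        ((ContinuousLinearMap.adjoint (symProblem s I S) (symProblem s I S f) :
          symSubspace s I H) : HilbertTensorPower d H)) ∧
    ∀ ψ : ℕ ≃ nabla s I, (Antitone fun v => lamProd lam (ψ v : Fin d → ℕ)) →
      IsEigenpairSequence
        ((ContinuousLinearMap.adjoint (symProblem s I S)).comp (symProblem s I S))
        (fun v => xi s I e (ψ v)) (fun v => lamProd lam (ψ v : Fin d → ℕ)) ∧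
      ((Submodule.span ℝ (Set.range e)).topologicalClosure = ⊤ →
        (Submodule.span ℝ (Set.range fun v => xi s I e (ψ v))).topologicalClosure = ⊤) ∧
      ∀ n : ℕ,
        (∀ f, optAlgorithm s I S e (fun v => ψ v) n f ∈ symSubspace s I G) ∧
        optAlgorithm s I S e (fun v => ψ v) n ∈
          linAlgorithms (symSubspace s I H) (HilbertTensorPower d G) n ∧
        worstCaseError (symProblem s I S) (optAlgorithm s I S e (fun v => ψ v) n) =
          ENNReal.ofReal √(lamProd lam (ψ n : Fin d → ℕ)) ∧
        ∀ 𝒜 : Set (symSubspace s I H → HilbertTensorPower d G),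
          linAlgorithms (symSubspace s I H) (HilbertTensorPower d G) n ⊆ 𝒜 →
          𝒜 ⊆ contAlgorithms (symSubspace s I H) (HilbertTensorPower d G) n ∪
            adaptAlgorithms (symSubspace s I H) (HilbertTensorPower d G) n →
          minimalError (symProblem s I S) 𝒜 =
            ENNReal.ofReal √(lamProd lam (ψ n : Fin d → ℕ)) := by
  refine ⟨exists_antitone_lamProd (by omega) s I he.antitone he.nonneg
      fun ε hε => he.tendsto_zero hS hε,
    fun f => adjoint_tensorOp_eq_adjoint_symProblem S f, fun ψ hψ => ?_⟩
  have hxi := isEigenpairSequence_xi he ψ hψ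
  refine ⟨hxi, fun htop => ?_, fun n => ?_⟩
  · have h := topologicalClosure_span_xi (s := s) (I := I) htop
    rwa [← ψ.surjective.range_comp] at h
  have hlin : optAlgorithm s I S e (fun v => ψ v) n ∈
      linAlgorithms (symSubspace s I H) (HilbertTensorPower d G) n := by
    refine ⟨fun v => innerSL ℝ (xi s I e (ψ v)), fun v => symProblem s I S (xi s I e (ψ v)),
      fun f => ?_⟩
    rw [optAlgorithm, Finset.sum_range]
    exact Finset.sum_congr rfl fun v _ => by rw [innerSL_apply_apply, real_inner_comm]
  have herr : worstCaseError (symProblem s I S) (optAlgorithm s I S e (fun v => ψ v) n) =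
      ENNReal.ofReal √(lamProd lam (ψ n : Fin d → ℕ)) := hxi.worstCaseError_spectral n
  refine ⟨fun f => ?_, hlin, herr, fun 𝒜 hsub hsup => le_antisymm ?_ ?_⟩
  · exact Submodule.sum_mem _ fun v _ =>
      Submodule.smul_mem _ _ (tensorOp_mem_symSubspace S (Subtype.property _))
  · rw [← herr]
    exact iInf₂_le _ (hsub hlin)
  · refine le_iInf₂ fun A hA => ?_
    rcases hsup hA with h | h
    · exact hxi.le_worstCaseError_of_mem_contAlgorithms h
    · exact hxi.le_worstCaseError_of_mem_adaptAlgorithms h
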